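/- Let $d,\sigma\ge 1$ be integers, $\mu\in\{1,-1\}$, and consider on $\mathbb R^d$ the nonlinear Schrödinger equation $$i\partial_t\psi+\tfrac12\Delta\psi=\mu|\psi|^{2\sigma}\psi,\qquad \psi(0,\cdot)=\psi_0. \tag{NLS}$$ For $1\le p\le\infty$ and $s\in\mathbb R$, the Fourier-Lebesgue space $\mathcal FL^p_s(\mathbb R^d)$ consists of the tempered distributions $f$ whose Fourier transform $\hat f$ is a function with $\|f\|_{\mathcal FL^p_s}:=\|(1+|\xi|^2)^{s/2}\hat f\|_{L^p(\mathbb R^d)}<\infty$, where $\hat f(\xi)=(2\pi)^{-d}\int_{\mathbb R^d}e^{-ix\cdot\xi}f(x)\,dx$ for Schwartz functions $f$. Let $M$ be the space of $f\in L^2(\mathbb R^d)$ with $\|f\|_M:=\sum_{n\in\mathbb Z^d}\|\hat f\|_{L^2(n+[-1/2,1/2)^d)}<\infty$. A solution of (NLS) on $[0,T]$ is a $\psi\in C([0,T];M)$ such that, for all $t\in[0,T]$, $$\psi(t)=e^{i\frac t2\Delta}\psi_0-i\mu\int_0^t e^{i\frac{t-\tau}2\Delta}\big(|\psi|^{2\sigma}\psi\big)(\tau)\,d\tau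 .$$ Put $s_c(p)=d\left(1-\frac1p\right)-\frac1\sigma$, with $\frac1\infty=0$. **Theorem.** Let $1\le p\le\infty$ and $s<\min(0,s_c(p))$. For every $\delta>0$ there exist $\psi_0\in\mathcal FL^p_s(\mathbb R^d)\cap M$ and $T$ with $$\|\psi_0\|_{\mathcal FL^p_s}<\delta,\qquad 0<T<\delta,$$ such that (NLS) has a solution $\psi$ on $[0,T]$, it is the only one, $\psi(t)\in\mathcal FL^p_s(\mathbb R^d)$ for all $t\in[0,T]$, and $$\|\psi(T)\|_{\mathcal FL^p_s}>\delta^{-1}.$$ -/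

import Mathlib

open MeasureTheory Filter Topology SchwartzMap
open scoped ENNReal FourierTransform

noncomputable section

namespace NLS

/-- Euclidean space `ℝ^d`. -/
abbrev Space (d : ℕ) : Type := EuclideanSpace ℝ (Fin d)

/-- Complex-valued `L²(ℝ^d)`. -/
abbrev L2 (d : ℕ) : Type := Lp ℂ 2 (volume : Measure (Space d))

/-- The dilation `ξ ↦ ξ / (2π)` of `ℝ^d`. -/
def dilation (d : ℕ) : Space d ≃L[ℝ] Space d :=
  ContinuousLinearEquiv.smulLeft (Units.mk0 ((2 * Real.pi)⁻¹ : ℝ) (by positivity))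

/-- The Fourier transform of Schwartz functions with the normalization
`φ̂(ξ) = (2π)^{-d} ∫ e^{-i x·ξ} φ(x) dx` (see `schwartzHat_apply`), obtained by rescaling Mathlib's
Fourier transform `∫ e^{-2πi x·ξ} φ(x) dx`. -/
def schwartzHat {d : ℕ} (φ : 𝓢(Space d, ℂ)) : 𝓢(Space d, ℂ) :=
  (((2 * Real.pi) ^ d : ℝ)⁻¹ : ℂ) • compCLMOfContinuousLinearEquiv ℂ (dilation d) (𝓕 φ)

theorem schwartzHat_apply {d : ℕ} (φ : 𝓢(Space d, ℂ)) (ξ : Space d) :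
    schwartzHat φ ξ = (((2 * Real.pi) ^ d : ℝ)⁻¹ : ℂ) *
      ∫ x : Space d, Complex.exp (-Complex.I * (inner ℝ x ξ : ℝ)) * φ x := by
  have h : schwartzHat φ ξ = (((2 * Real.pi) ^ d : ℝ)⁻¹ : ℂ) *
      (𝓕 (φ : Space d → ℂ)) ((2 * Real.pi)⁻¹ • ξ) := by
    rw [← SchwartzMap.fourier_coe]; rfl
  rw [h, Real.fourier_eq']
  congr 1
  refine integral_congr_ae (Eventually.of_forall fun x => ?_)
  simp only [smul_eq_mul, inner_smul_right]
  congr 2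
  have : (Real.pi : ℂ) ≠ 0 := by exact_mod_cast Real.pi_ne_zero
  push_cast
  field_simp

/-- The Fourier transform `f̂` of the tempered distribution `f`, defined by duality
`⟨f̂, φ⟩ = ⟨f, φ̂⟩`, is the function `g`. -/
def HasFourierDensity {d : ℕ} (f : 𝓢'(Space d, ℂ)) (g : Space d → ℂ) : Prop :=
  AEStronglyMeasurable g volume ∧
    ∀ φ : 𝓢(Space d, ℂ), Integrable (fun ξ => g ξ * φ ξ) volume ∧
      f (schwartzHat φ) = ∫ ξ, g ξ * φ ξ

/-- The Fourier-Lebesgue norm `‖f‖_{𝓕L^p_s} = ‖⟨ξ⟩^s f̂‖_{L^p}`, `⟨ξ⟩ = (1 + |ξ|²)^{1/2}`.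
It is `∞` if `f̂` is not a function; a function `f̂` is unique up to null sets, so that the
infimum is over a single value. -/
def flNorm {d : ℕ} (p : ℝ≥0∞) (s : ℝ) (f : 𝓢'(Space d, ℂ)) : ℝ≥0∞ :=
  ⨅ (g : Space d → ℂ) (_ : HasFourierDensity f g),
    eLpNorm (fun ξ => (((1 + ‖ξ‖ ^ 2) ^ (s / 2) : ℝ) : ℂ) * g ξ) p volume

/-- The Fourier-Lebesgue space `𝓕L^p_s(ℝ^d)`. -/
def MemFL {d : ℕ} (p : ℝ≥0∞) (s : ℝ) (f : 𝓢'(Space d, ℂ)) : Prop :=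
  flNorm p s f < ∞

/-- The unit cube `n + [-1/2, 1/2)^d`. -/
def unitCube {d : ℕ} (n : Fin d → ℤ) : Set (Space d) :=
  {ξ | ∀ j, (n j : ℝ) - 1 / 2 ≤ ξ j ∧ ξ j < (n j : ℝ) + 1 / 2}

/-- The norm of the space `M`: `‖f‖_M = ∑_{n ∈ ℤ^d} ‖f̂‖_{L²(n + [-1/2,1/2)^d)}`. The elements of
`L²` at which it is finite form the completion of the test functions for it, a Banach algebra of
bounded continuous functions. -/
def mNorm {d : ℕ} (f : L2 d) : ℝ≥0∞ :=
  ⨅ (g : Space d → ℂ) (_ : HasFourierDensity (f : 𝓢'(Space d, ℂ)) g),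
    ∑' n : Fin d → ℤ, eLpNorm g 2 (volume.restrict (unitCube n))

theorem memLp_schrodinger {d : ℕ} (t : ℝ) (f : L2 d) :
    MemLp (fun ξ => Complex.exp (-Complex.I * ((t / 2 * ‖(2 * Real.pi) • ξ‖ ^ 2 : ℝ) : ℂ)) * f ξ) 2
      (volume : Measure (Space d)) := by
  refine (Lp.memLp f).of_le ?_ (Eventually.of_forall fun ξ => ?_)
  · refine AEStronglyMeasurable.mul (Continuous.aestronglyMeasurable (by fun_prop))
      (Lp.aestronglyMeasurable f)
  · rw [norm_mul, show -Complex.I * ((t / 2 * ‖(2 * Real.pi) • ξ‖ ^ 2 : ℝ) : ℂ)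
      = ((-(t / 2 * ‖(2 * Real.pi) • ξ‖ ^ 2) : ℝ) : ℂ) * Complex.I by push_cast; ring,
      Complex.norm_exp_ofReal_mul_I, one_mul]

/-- The Schrödinger propagator `e^{i (t/2) Δ}` on `L²`, i.e. the Fourier multiplier
`e^{-i (t/2) |ξ|²}`. Mathlib's frequency variable is `ξ / (2π)`, whence the factor `2π`. -/
def schrodinger {d : ℕ} (t : ℝ) (f : L2 d) : L2 d :=
  𝓕⁻ (memLp_schrodinger t (𝓕 f)).toLp

/-- The nonlinearity `|f|^{2σ} f` as a function. -/
def powerFun {d : ℕ} (σ : ℕ) (f : L2 d) : Space d → ℂ :=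
  fun x => ((‖f x‖ ^ (2 * σ) : ℝ) : ℂ) * f x

open Classical in
/-- The nonlinearity `|f|^{2σ} f` as an element of `L²`. (The value `0` when it is not in `L²` is
never used: `IsSolution` demands that it is in `L²`.) -/
def power {d : ℕ} (σ : ℕ) (f : L2 d) : L2 d :=
  if h : MemLp (powerFun σ f) 2 (volume : Measure (Space d)) then h.toLp else 0

/-- `ψ ∈ C([0,T]; M)` is a solution on `[0,T]` of `i ∂_t ψ + Δψ/2 = μ |ψ|^{2σ} ψ`, `ψ(0) = ψ₀`,
i.e. of the integral equation
`ψ(t) = e^{i(t/2)Δ} ψ₀ - i μ ∫_0^t e^{i((t-τ)/2)Δ} (|ψ|^{2σ} ψ)(τ) dτ`. -/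
structure IsSolution {d : ℕ} (σ : ℕ) (μ T : ℝ) (ψ₀ : L2 d) (ψ : ℝ → L2 d) : Prop where
  mem : ∀ t ∈ Set.Icc 0 T, mNorm (ψ t) < ∞
  continuous : ∀ t ∈ Set.Icc 0 T,
    Tendsto (fun τ => mNorm (ψ τ - ψ t)) (𝓝[Set.Icc 0 T] t) (𝓝 0)
  power_mem : ∀ t ∈ Set.Icc 0 T, MemLp (powerFun σ (ψ t)) 2 (volume : Measure (Space d))
  integrable : ∀ t ∈ Set.Icc 0 T,
    IntervalIntegrable (fun τ => schrodinger (t - τ) (power σ (ψ τ))) volume 0 t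
  duhamel : ∀ t ∈ Set.Icc 0 T,
    ψ t = schrodinger t ψ₀ -
      (Complex.I * (μ : ℂ)) • ∫ τ in (0 : ℝ)..t, schrodinger (t - τ) (power σ (ψ τ))

/-- The critical exponent `s_c(p) = d (1 - 1/p) - 1/σ`, with `1/∞ = 0`. -/
def criticalExponent (d σ : ℕ) (p : ℝ≥0∞) : ℝ :=
  (d : ℝ) * (1 - (p⁻¹).toReal) - 1 / (σ : ℝ)

end NLS

end

/-!
Norm inflation comes from a high-to-low frequency cascade that is visible in the first nonlinear
Picard iterate. The Fourier transform of the data consists of two bumps of height `R` and width `A`,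
at the frequencies `v` and `2v`, where `|v| = N` is much larger than `A`. As the Sobolev index `s`
is negative, the data is small in `𝓕L^p_s` for `R = N^{-s-ε} A^{-d/p}`. The resonance `v - 2v + v = 0`
sends a part of the mass to frequencies `≲ A`, where the weight is only `A^s`. If `T N² → 0`, the
phases of the linear flow do not rotate up to time `T`, and the first iterate at time `T` has height
`ρ R` on a ball of radius `≳ A`, with `ρ ~ T (R A^d)^{2σ}`; all further contributions have height
`O(ρ² R)`. For a small constant `ρ` the norm at time `T` is therefore `≳ R A^{s+d/p}`, which is
`N^{-ε-θs}` for `A = N^{1-θ}` and tends to infinity if `ε < θ|s|`. The condition `T N² → 0` holds for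
small `θ` and `ε` precisely because `s < s_c(p)` (`exists_parameters`).

The solution is constructed on the Fourier side, among the functions dominated by a multiple of an
envelope `G` with `G * G ≤ K G` (`IsEnvelope`). Convolution, the nonlinearity and the Duhamel map are
then controlled pointwise by `K` and the size of the multiple, so that a single fixed point argument
in a space of bounded continuous functions (`IsEnvelope.exists_eq_duhamelMap`) yields existence, and
the same pointwise bounds show that the first iterate dominates
(`IsEnvelope.le_norm_of_data_eq_zero`). To have `K ~ A^d` although the data sits at the distance `N`,
the envelope consists of bumps of width `A` around all integer multiples of `v`, with the summable
weights `1 / (1 + j²)` (`isEnvelope_envelope`).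

An inverse Fourier transform turns this into a solution in the sense of `IsSolution`
(`IsEnvelope.isSolution_ofFourier`). Uniqueness (`IsSolution.unique`) follows from the embedding of
`M` in `L^∞` and an iteration of Duhamel's formula in `L²`. The tempered distributions enter only
through the uniqueness of the Fourier density, which evaluates `flNorm` and `mNorm` (`flNorm_eq`,
`mNorm_eq`).
-/

noncomputable section

namespace NLS

open scoped BoundedContinuousFunction

/-! ### Fourier densities -/

/-- Schwartz functions separate locally integrable functions, even without the assumption that all
the pairings converge. -/
theorem ae_eq_of_integral_mul_schwartz_eq {d : ℕ} {g₁ g₂ : Space d → ℂ}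
    (h₁ : LocallyIntegrable g₁) (h₂ : LocallyIntegrable g₂)
    (h : ∀ φ : 𝓢(Space d, ℂ), ∫ ξ, g₁ ξ * φ ξ = ∫ ξ, g₂ ξ * φ ξ) : g₁ =ᵐ[volume] g₂ := by
  refine ae_eq_of_integral_contDiff_smul_eq h₁ h₂ fun φ hφ hc => ?_
  have hc' : HasCompactSupport (Complex.ofRealCLM ∘ φ) := hc.comp_left rfl
  have hφ' : ContDiff ℝ ((⊤ : ℕ∞) : WithTop ℕ∞) (Complex.ofRealCLM ∘ φ) := by fun_prop
  have := h (hc'.toSchwartzMap hφ')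
  simpa [mul_comm] using this

/-- The pairings with Schwartz functions that are `1` on a given ball give local integrability. -/
theorem HasFourierDensity.locallyIntegrable {d : ℕ} {f : 𝓢'(Space d, ℂ)} {g : Space d → ℂ}
    (h : HasFourierDensity f g) : LocallyIntegrable g := by
  rw [locallyIntegrable_iff]
  intro k hk
  obtain ⟨r, hr⟩ := hk.isBounded.subset_ball (0 : Space d)
  by_cases hr0 : 0 < r
  swap
  · have : k = ∅ := by
      rw [Metric.ball_eq_empty.2 (not_lt.1 hr0)] at hr
      exact Set.subset_empty_iff.1 hr
    simp [this]
  let b : ContDiffBump (0 : Space d) := ⟨r, 2 * r, hr0, by linarith⟩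
  have hc' : HasCompactSupport (Complex.ofRealCLM ∘ b) := b.hasCompactSupport.comp_left rfl
  have hφ' : ContDiff ℝ ((⊤ : ℕ∞) : WithTop ℕ∞) (Complex.ofRealCLM ∘ b) :=
    Complex.ofRealCLM.contDiff.comp b.contDiff
  have := (h.2 (hc'.toSchwartzMap hφ')).1
  refine (this.integrableOn (s := k)).congr_fun_ae ?_
  filter_upwards [ae_restrict_mem hk.measurableSet] with x hx
  have : b x = 1 := b.one_of_mem_closedBall (Metric.ball_subset_closedBall (hr hx))
  simp [this]

theorem HasFourierDensity.ae_eq {d : ℕ} {f : 𝓢'(Space d, ℂ)} {g₁ g₂ : Space d → ℂ}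
    (h₁ : HasFourierDensity f g₁) (h₂ : HasFourierDensity f g₂) : g₁ =ᵐ[volume] g₂ :=
  ae_eq_of_integral_mul_schwartz_eq h₁.locallyIntegrable h₂.locallyIntegrable fun φ => by
    rw [← (h₁.2 φ).2, ← (h₂.2 φ).2]

theorem flNorm_eq {d : ℕ} {f : 𝓢'(Space d, ℂ)} {g : Space d → ℂ} (h : HasFourierDensity f g)
    (p : ℝ≥0∞) (s : ℝ) : flNorm p s f =
      eLpNorm (fun ξ => (((1 + ‖ξ‖ ^ 2) ^ (s / 2) : ℝ) : ℂ) * g ξ) p volume := by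
  refine le_antisymm (iInf₂_le g h) (le_iInf₂ fun g' h' => le_of_eq (eLpNorm_congr_ae ?_))
  filter_upwards [h.ae_eq h'] with x hx
  rw [hx]

theorem mNorm_eq {d : ℕ} {f : L2 d} {g : Space d → ℂ}
    (h : HasFourierDensity (f : 𝓢'(Space d, ℂ)) g) :
    mNorm f = ∑' n : Fin d → ℤ, eLpNorm g 2 (volume.restrict (unitCube n)) := by
  refine le_antisymm (iInf₂_le g h) (le_iInf₂ fun g' h' => le_of_eq ?_)
  exact tsum_congr fun n => eLpNorm_congr_ae (ae_restrict_of_ae (h.ae_eq h'))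

/-- The rescaling `ξ ↦ (2π)^{-d} g(ξ / 2π)` that turns Mathlib's Fourier transform into `f̂`. -/
def rescale {d : ℕ} (g : Space d → ℂ) : Space d → ℂ :=
  fun ξ => (((2 * Real.pi) ^ d : ℝ)⁻¹ : ℂ) * g ((2 * Real.pi)⁻¹ • ξ)

theorem aestronglyMeasurable_rescale {d : ℕ} {g : Space d → ℂ}
    (hg : AEStronglyMeasurable g volume) : AEStronglyMeasurable (rescale g) volume := by
  refine AEStronglyMeasurable.const_mul ?_ _
  refine hg.comp_quasiMeasurePreserving ⟨by fun_prop, ?_⟩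
  rw [Measure.map_addHaar_smul _ (by positivity)]
  exact Measure.smul_absolutelyContinuous

theorem integral_rescale_mul {d : ℕ} (g h : Space d → ℂ) :
    ∫ ξ, rescale g ξ * h ξ = ∫ ξ, g ξ * h ((2 * Real.pi) • ξ) := by
  have hpi : (2 * Real.pi) ≠ 0 := by positivity
  have := Measure.integral_comp_smul (volume : Measure (Space d))
    (fun ξ => g ξ * h ((2 * Real.pi) • ξ)) (2 * Real.pi)⁻¹
  simp only [smul_smul, mul_inv_cancel₀ hpi, one_smul] at this
  simp only [rescale, mul_assoc]
  rw [integral_const_mul, this, finrank_euclideanSpace_fin]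
  rw [abs_of_pos (by positivity), inv_pow, inv_inv, Complex.real_smul, ← mul_assoc]
  rw [inv_mul_cancel₀, one_mul]
  exact_mod_cast (by positivity)

theorem integrable_rescale_mul {d : ℕ} {g h : Space d → ℂ}
    (H : Integrable fun ξ => g ξ * h ((2 * Real.pi) • ξ)) :
    Integrable fun ξ => rescale g ξ * h ξ := by
  have hpi : (2 * Real.pi) ≠ 0 := by positivity
  have := H.comp_smul (inv_ne_zero hpi)
  simp only [smul_smul, mul_inv_cancel₀ hpi, one_smul] at this
  simpa only [rescale, mul_assoc] using this.const_mul (((2 * Real.pi) ^ d : ℝ)⁻¹ : ℂ)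

/-- The dilate `ξ ↦ φ(2πξ)` of a Schwartz function. -/
def dilate {d : ℕ} (φ : 𝓢(Space d, ℂ)) : 𝓢(Space d, ℂ) :=
  compCLMOfContinuousLinearEquiv ℂ (dilation d).symm φ

theorem dilate_apply {d : ℕ} (φ : 𝓢(Space d, ℂ)) (ξ : Space d) :
    dilate φ ξ = φ ((2 * Real.pi) • ξ) := by
  have : (dilation d).symm ξ = (2 * Real.pi) • ξ := by
    rw [ContinuousLinearEquiv.symm_apply_eq]
    change ξ = (2 * Real.pi)⁻¹ • ((2 * Real.pi) • ξ)
    rw [smul_smul, inv_mul_cancel₀ (by positivity), one_smul]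
  rw [dilate, ← this]; rfl

/-- Mathlib's Fourier transform intertwines the dilation with the normalization of `f̂`. -/
theorem fourier_dilate {d : ℕ} (φ : 𝓢(Space d, ℂ)) : 𝓕 (dilate φ) = schwartzHat φ := by
  ext ξ
  rw [schwartzHat_apply, SchwartzMap.fourier_coe, Real.fourier_eq']
  have := Measure.integral_comp_smul (volume : Measure (Space d))
    (fun x => Complex.exp (-Complex.I * (inner ℝ x ξ : ℝ)) * φ x) (2 * Real.pi)
  rw [finrank_euclideanSpace_fin, abs_of_pos (by positivity), Complex.real_smul] at this
  push_cast at this ⊢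
  rw [← this]
  refine integral_congr_ae (Eventually.of_forall fun x => ?_)
  simp only [smul_eq_mul, dilate_apply, inner_smul_left]
  congr 2
  simp
  ring

theorem integrable_mul_schwartz {d : ℕ} (f : L2 d) (φ : 𝓢(Space d, ℂ)) :
    Integrable (fun ξ => f ξ * φ ξ) :=
  (Lp.memLp f).integrable_mul (φ.memLp 2 volume)

/-- The density of `f̂` for `f ∈ L²` is the rescaled `L²` Fourier transform of Mathlib. -/
theorem hasFourierDensity_rescale {d : ℕ} (f : L2 d) :
    HasFourierDensity (f : 𝓢'(Space d, ℂ)) (rescale (𝓕 f : L2 d)) := by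
  refine ⟨aestronglyMeasurable_rescale (Lp.aestronglyMeasurable _), fun φ => ⟨?_, ?_⟩⟩
  · refine integrable_rescale_mul ?_
    simpa only [dilate_apply] using integrable_mul_schwartz (𝓕 f : L2 d) (dilate φ)
  · rw [integral_rescale_mul, ← fourier_dilate]
    have := congrArg (fun T => T (dilate φ)) (Lp.fourier_toTemperedDistribution_eq f)
    simp only [TemperedDistribution.fourier_apply] at this
    rw [this, Lp.toTemperedDistribution_apply]
    simp only [dilate_apply, smul_eq_mul, mul_comm]

theorem rescale_congr_ae {d : ℕ} {g₁ g₂ : Space d → ℂ} (h : g₁ =ᵐ[volume] g₂) :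
    rescale g₁ =ᵐ[volume] rescale g₂ := by
  have hq : Measure.QuasiMeasurePreserving (fun ξ : Space d => (2 * Real.pi)⁻¹ • ξ) := by
    refine ⟨by fun_prop, ?_⟩
    rw [Measure.map_addHaar_smul _ (by positivity)]
    exact Measure.smul_absolutelyContinuous
  filter_upwards [hq.ae h] with ξ hξ
  simp only [rescale, hξ]

/-! ### Inverse Fourier transforms of integrable functions in `L²` -/

theorem integral_fourierInv_mul {d : ℕ} {g : Space d → ℂ} (hg : Integrable g)
    (φ : 𝓢(Space d, ℂ)) : ∫ x, (𝓕⁻ g) x * φ x = ∫ ξ, g ξ * (𝓕⁻ φ) ξ := by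
  have := VectorFourier.integral_fourierIntegral_smul_eq_flip (μ := (volume : Measure (Space d)))
    (ν := (volume : Measure (Space d))) (f := g) (g := φ) (L := -innerₗ (Space d))
    (e := Real.fourierChar) Real.continuous_fourierChar (by simp; fun_prop) hg φ.integrable
  rw [SchwartzMap.fourierInv_coe]
  simp only [Real.fourierInv_eq]
  simpa [VectorFourier.fourierIntegral, real_inner_comm] using this

theorem continuous_fourierInv {d : ℕ} {g : Space d → ℂ} (hg : Integrable g) :
    Continuous (𝓕⁻ g) := by
  rw [Real.fourierInv_eq_fourier_comp_neg]
  exact VectorFourier.fourierIntegral_continuous Real.continuous_fourierChar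
    (by simp; fun_prop) hg.comp_neg

/-- On `L¹ ∩ L²` the inverse Fourier transform of `L²` is given by the Fourier integral, since both
have the same pairings with Schwartz functions. -/
theorem fourierInv_toLp_ae_eq {d : ℕ} {g : Space d → ℂ} (hg : Integrable g) (hg2 : MemLp g 2) :
    (𝓕⁻ (hg2.toLp g : L2 d) : L2 d) =ᵐ[volume] 𝓕⁻ g := by
  refine ae_eq_of_integral_mul_schwartz_eq
    ((Lp.memLp _).locallyIntegrable (by norm_num)) ?_ fun φ => ?_
  · exact (continuous_fourierInv hg).locallyIntegrable
  · have := congrArg (fun T => T φ) (Lp.fourierInv_toTemperedDistribution_eq (hg2.toLp g : L2 d))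
    simp only [TemperedDistribution.fourierInv_apply, Lp.toTemperedDistribution_apply] at this
    rw [integral_fourierInv_mul hg]
    simp only [mul_comm, smul_eq_mul] at this ⊢
    rw [← this]
    refine integral_congr_ae ?_
    filter_upwards [hg2.coeFn_toLp] with x hx
    rw [hx]

theorem norm_fourierInv_le {d : ℕ} (g : Space d → ℂ) (x : Space d) :
    ‖(𝓕⁻ g) x‖ ≤ ∫ ξ, ‖g ξ‖ := by
  rw [Real.fourierInv_eq]
  refine (norm_integral_le_integral_norm _).trans (le_of_eq ?_)
  simp

/-! ### The norm of `M` -/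

theorem mNorm_eq_rescale {d : ℕ} (f : L2 d) : mNorm f =
    ∑' n : Fin d → ℤ, eLpNorm (rescale (𝓕 f : L2 d)) 2 (volume.restrict (unitCube n)) :=
  mNorm_eq (hasFourierDensity_rescale f)

theorem iUnion_unitCube (d : ℕ) : ⋃ n : Fin d → ℤ, unitCube n = (Set.univ : Set (Space d)) := by
  refine Set.eq_univ_of_forall fun ξ => Set.mem_iUnion.2 ⟨fun j => ⌊ξ j + 1 / 2⌋, fun j => ?_⟩
  have h₁ := Int.floor_le (ξ j + 1 / 2)
  have h₂ := Int.lt_floor_add_one (ξ j + 1 / 2)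
  constructor <;> linarith

theorem unitCube_eq_preimage {d : ℕ} (n : Fin d → ℤ) : (unitCube n : Set (Space d)) =
    (WithLp.ofLp : Space d → Fin d → ℝ) ⁻¹'
      Set.univ.pi fun j => Set.Ico ((n j : ℝ) - 1 / 2) ((n j : ℝ) + 1 / 2) := by
  ext ξ; simp [unitCube]

theorem measurableSet_unitCube {d : ℕ} (n : Fin d → ℤ) :
    MeasurableSet (unitCube n : Set (Space d)) := by
  rw [unitCube_eq_preimage]
  exact (PiLp.volume_preserving_ofLp (Fin d)).measurable
    (MeasurableSet.univ_pi fun j => measurableSet_Ico)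

theorem volume_unitCube {d : ℕ} (n : Fin d → ℤ) : volume (unitCube n : Set (Space d)) = 1 := by
  rw [unitCube_eq_preimage, (PiLp.volume_preserving_ofLp (Fin d)).measure_preimage
    (MeasurableSet.univ_pi fun j => measurableSet_Ico).nullMeasurableSet, volume_pi_pi]
  refine Finset.prod_eq_one fun j _ => ?_
  rw [Real.volume_Ico]
  norm_num

theorem lintegral_enorm_le_tsum {d : ℕ} {g : Space d → ℂ} (hg : AEStronglyMeasurable g volume) :
    ∫⁻ ξ, ‖g ξ‖ₑ ≤ ∑' n : Fin d → ℤ, eLpNorm g 2 (volume.restrict (unitCube n)) := by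
  calc ∫⁻ ξ, ‖g ξ‖ₑ = ∫⁻ ξ in ⋃ n : Fin d → ℤ, unitCube n, ‖g ξ‖ₑ := by
        rw [iUnion_unitCube, Measure.restrict_univ]
    _ ≤ ∑' n : Fin d → ℤ, ∫⁻ ξ in unitCube n, ‖g ξ‖ₑ := lintegral_iUnion_le _ _
    _ ≤ _ := ENNReal.tsum_le_tsum fun n => by
      have : IsProbabilityMeasure (volume.restrict (unitCube n : Set (Space d))) :=
        ⟨by rw [Measure.restrict_apply_univ, volume_unitCube]⟩
      rw [← eLpNorm_one_eq_lintegral_enorm]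
      exact eLpNorm_le_eLpNorm_of_exponent_le (by norm_num) hg.restrict

theorem lintegral_enorm_rescale {d : ℕ} (g : Space d → ℂ) :
    ∫⁻ ξ, ‖rescale g ξ‖ₑ = ∫⁻ ξ, ‖g ξ‖ₑ := by
  have h2 : (0 : ℝ) < 2 * Real.pi := by positivity
  have he : MeasurableEmbedding (fun ξ : Space d => (2 * Real.pi)⁻¹ • ξ) :=
    (Homeomorph.smulOfNeZero _ (inv_ne_zero h2.ne')).measurableEmbedding
  have h := he.lintegral_map (μ := volume) (fun ξ => ‖g ξ‖ₑ)
  rw [Measure.map_addHaar_smul _ (inv_ne_zero h2.ne'), finrank_euclideanSpace_fin,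
    lintegral_smul_measure, inv_pow, inv_inv, abs_of_pos (by positivity)] at h
  simp only [rescale, enorm_mul]
  rw [lintegral_const_mul' _ _ (by simp), ← h, smul_eq_mul, ← mul_assoc]
  have : ‖(((2 * Real.pi) ^ d : ℝ)⁻¹ : ℂ)‖ₑ = (ENNReal.ofReal ((2 * Real.pi) ^ d))⁻¹ := by
    rw [← ENNReal.ofReal_inv_of_pos (by positivity), ← Complex.ofReal_inv, ← ofReal_norm,
      Complex.norm_real, Real.norm_of_nonneg (by positivity)]
  rw [this, ENNReal.inv_mul_cancel, one_mul]
  · simp; positivity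
  · simp

/-- The embedding of `M` in `L^∞`: on cubes of measure `1` the `L¹` norm is at most the `L²` norm, so
the Fourier transform is integrable. -/
theorem norm_le_mNorm {d : ℕ} (f : L2 d) (hf : mNorm f < ∞) :
    ∀ᵐ x, ‖f x‖ ≤ (mNorm f).toReal := by
  have hm : AEStronglyMeasurable (𝓕 f : L2 d) volume := Lp.aestronglyMeasurable _
  have hle : ∫⁻ ξ, ‖(𝓕 f : L2 d) ξ‖ₑ ≤ mNorm f := by
    rw [← lintegral_enorm_rescale, mNorm_eq_rescale]
    exact lintegral_enorm_le_tsum (aestronglyMeasurable_rescale hm)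
  have hint : Integrable (𝓕 f : L2 d) volume := ⟨hm, hle.trans_lt hf⟩
  have hae := fourierInv_toLp_ae_eq hint (Lp.memLp _)
  rw [Lp.toLp_coeFn, FourierTransform.fourierInv_fourier_eq] at hae
  filter_upwards [hae] with x hx
  rw [hx]
  refine (norm_fourierInv_le _ x).trans ?_
  rw [integral_norm_eq_lintegral_enorm hm]
  exact ENNReal.toReal_mono hf.ne hle

theorem mNorm_le_add {d : ℕ} (f g : L2 d) : mNorm f ≤ mNorm g + mNorm (f - g) := by
  simp only [mNorm_eq_rescale]
  rw [← ENNReal.tsum_add]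
  refine ENNReal.tsum_le_tsum fun n => ?_
  have hm : ∀ f : L2 d, AEStronglyMeasurable (rescale (𝓕 f : L2 d))
      (volume.restrict (unitCube n)) := fun f =>
    (aestronglyMeasurable_rescale (Lp.aestronglyMeasurable _)).restrict
  refine le_trans (le_of_eq (eLpNorm_congr_ae (ae_restrict_of_ae ?_)))
    (eLpNorm_add_le (hm g) (hm (f - g)) (by norm_num))
  have h1 : 𝓕 f = 𝓕 g + 𝓕 (f - g) := by rw [← FourierTransform.fourier_add]; congr 1; abel
  refine (rescale_congr_ae (h1 ▸ Lp.coeFn_add (𝓕 g) (𝓕 (f - g)))).trans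
    (Eventually.of_forall fun ξ => ?_)
  simp only [rescale, Pi.add_apply, mul_add]

/-! ### Convolution of functions dominated by an envelope -/

/-- An envelope: a positive integrable weight `G ≤ 1`, which dominates its self-convolution,
`G * G ≤ K G`, and which is slowly varying. The functions dominated by multiples of `G` form a
convolution algebra. -/
structure IsEnvelope {d : ℕ} (G : Space d → ℝ) (K : ℝ) : Prop where
  continuous : Continuous G
  pos : ∀ x, 0 < G x
  le_one : ∀ x, G x ≤ 1
  even : ∀ x, G (-x) = G x
  integrable : Integrable G
  integral_le : ∀ x, ∫ y, G y * G (x - y) ≤ K * G x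
  slow : ∀ r : ℝ, ∃ C : ℝ, 0 ≤ C ∧ ∀ x y, ‖x - y‖ ≤ r → G x ≤ C * G y

/-- The convolution of complex-valued functions. -/
def conv {d : ℕ} (f g : Space d → ℂ) (x : Space d) : ℂ := ∫ y, f y * g (x - y)

/-- The involution `f ↦ conj f(-·)`, the conjugation on the Fourier side. -/
def invol {d : ℕ} (f : Space d → ℂ) (x : Space d) : ℂ := (starRingEnd ℂ) (f (-x))

/-- The map `f ↦ (f * f~)^{*k} * f`, that is, `ψ ↦ |ψ|^{2k} ψ` on the Fourier side. -/
def convPow {d : ℕ} : ℕ → (Space d → ℂ) → Space d → ℂ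
  | 0, f => f
  | k + 1, f => conv (conv f (invol f)) (convPow k f)

namespace IsEnvelope

variable {d : ℕ} {G : Space d → ℝ} {K : ℝ}

theorem integrable_mul (hG : IsEnvelope G K) (x : Space d) :
    Integrable fun y => G y * G (x - y) := by
  refine hG.integrable.mono' (by have := hG.continuous; fun_prop) (Eventually.of_forall fun y => ?_)
  rw [norm_mul, Real.norm_of_nonneg (hG.pos _).le, Real.norm_of_nonneg (hG.pos _).le]
  exact mul_le_of_le_one_right (hG.pos _).le (hG.le_one _)

theorem K_nonneg (hG : IsEnvelope G K) : 0 ≤ K := by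
  have h := hG.integral_le 0
  have h0 : 0 ≤ ∫ y, G y * G (0 - y) :=
    integral_nonneg fun y => mul_nonneg (hG.pos _).le (hG.pos _).le
  exact nonneg_of_mul_nonneg_left (h0.trans h) (hG.pos 0)

theorem norm_conv_le (hG : IsEnvelope G K) {f g : Space d → ℂ} {r s : ℝ} (hr : 0 ≤ r)
    (hf : ∀ x, ‖f x‖ ≤ r * G x) (hg : ∀ x, ‖g x‖ ≤ s * G x) (x : Space d) :
    ‖conv f g x‖ ≤ K * r * s * G x := by
  have hs : 0 ≤ s := nonneg_of_mul_nonneg_left ((norm_nonneg _).trans (hg 0)) (hG.pos 0)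
  calc ‖conv f g x‖ ≤ ∫ y, (r * s) * (G y * G (x - y)) := by
        refine norm_integral_le_of_norm_le ((hG.integrable_mul x).const_mul _)
          (Eventually.of_forall fun y => ?_)
        rw [norm_mul]
        calc _ ≤ (r * G y) * (s * G (x - y)) :=
              mul_le_mul (hf _) (hg _) (norm_nonneg _) (mul_nonneg hr (hG.pos _).le)
          _ = _ := by ring
    _ = (r * s) * ∫ y, G y * G (x - y) := integral_const_mul _ _
    _ ≤ (r * s) * (K * G x) := by gcongr; exact hG.integral_le x
    _ = _ := by ring

theorem integrable_conv (hG : IsEnvelope G K) {f g : Space d → ℂ} {r s : ℝ} (hr : 0 ≤ r)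
    (hfc : Continuous f) (hgc : Continuous g)
    (hf : ∀ x, ‖f x‖ ≤ r * G x) (hg : ∀ x, ‖g x‖ ≤ s * G x) (x : Space d) :
    Integrable fun y => f y * g (x - y) := by
  refine ((hG.integrable_mul x).const_mul (r * s)).mono' (by fun_prop)
    (Eventually.of_forall fun y => ?_)
  rw [norm_mul]
  calc _ ≤ (r * G y) * (s * G (x - y)) :=
        mul_le_mul (hf _) (hg _) (norm_nonneg _) (mul_nonneg hr (hG.pos _).le)
    _ = _ := by ring

theorem continuous_conv (hG : IsEnvelope G K) {f g : ℝ → Space d → ℂ} {r s : ℝ} (hr : 0 ≤ r)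
    (hfc : Continuous (Function.uncurry f)) (hgc : Continuous (Function.uncurry g))
    (hf : ∀ t x, ‖f t x‖ ≤ r * G x) (hg : ∀ t x, ‖g t x‖ ≤ s * G x) :
    Continuous (Function.uncurry fun t => conv (f t) (g t)) := by
  have hs : 0 ≤ s := nonneg_of_mul_nonneg_left ((norm_nonneg _).trans (hg 0 0)) (hG.pos 0)
  have hfc' : ∀ {X : Type} [TopologicalSpace X] (a : X → ℝ) (b : X → Space d), Continuous a →
      Continuous b → Continuous fun z => f (a z) (b z) := fun a b ha hb =>
    hfc.comp (ha.prodMk hb)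
  have hgc' : ∀ {X : Type} [TopologicalSpace X] (a : X → ℝ) (b : X → Space d), Continuous a →
      Continuous b → Continuous fun z => g (a z) (b z) := fun a b ha hb =>
    hgc.comp (ha.prodMk hb)
  refine continuous_of_dominated (F := fun (z : ℝ × Space d) y => f z.1 y * g z.1 (z.2 - y))
    (bound := fun y => (r * s) * G y) (fun z => ?_) (fun z => Eventually.of_forall fun y => ?_)
    (hG.integrable.const_mul _) (Eventually.of_forall fun y => ?_)
  · exact ((hfc' _ _ continuous_const continuous_id).mul
      (hgc' _ _ continuous_const (by fun_prop))).aestronglyMeasurable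
  · rw [norm_mul]
    calc _ ≤ (r * G y) * (s * G (z.2 - y)) :=
          mul_le_mul (hf _ _) (hg _ _) (norm_nonneg _) (mul_nonneg hr (hG.pos _).le)
      _ ≤ (r * G y) * (s * 1) := by
          gcongr
          · exact mul_nonneg hr (hG.pos _).le
          · exact hG.le_one _
      _ = _ := by ring
  · exact (hfc' _ _ continuous_fst continuous_const).mul
      (hgc' _ _ continuous_fst (by fun_prop))

theorem norm_conv_sub_le (hG : IsEnvelope G K) {f g f' g' : Space d → ℂ} {r s a b : ℝ}
    (hr : 0 ≤ r) (ha : 0 ≤ a)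
    (hfc : Continuous f) (hgc : Continuous g) (hfc' : Continuous f') (hgc' : Continuous g')
    (hg : ∀ x, ‖g x‖ ≤ s * G x) (hf' : ∀ x, ‖f' x‖ ≤ r * G x)
    (hff : ∀ x, ‖f x - f' x‖ ≤ a * G x) (hgg : ∀ x, ‖g x - g' x‖ ≤ b * G x) (x : Space d) :
    ‖conv f g x - conv f' g' x‖ ≤ K * (a * s + r * b) * G x := by
  have h : conv f g x - conv f' g' x = conv (f - f') g x + conv f' (g - g') x := by
    have hi₁ := hG.integrable_conv ha (hfc.sub hfc') hgc hff hg x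
    have hi₂ := hG.integrable_conv hr hfc' (hgc.sub hgc') hf' hgg x
    have hi₃ := hG.integrable_conv hr hfc' hgc hf' hg x
    have hi₄ : Integrable fun y => f y * g (x - y) := by
      refine (hi₁.add hi₃).congr (Eventually.of_forall fun y => ?_)
      simp; ring
    have hi₅ : Integrable fun y => f' y * g' (x - y) := by
      refine (hi₃.sub hi₂).congr (Eventually.of_forall fun y => ?_)
      simp; ring
    simp only [conv]
    rw [← integral_sub hi₄ hi₅, ← integral_add hi₁ hi₂]
    refine integral_congr_ae (Eventually.of_forall fun y => ?_)
    simp; ring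
  rw [h]
  refine (norm_add_le _ _).trans ?_
  have h₁ := hG.norm_conv_le ha (f := f - f') hff hg x
  have h₂ := hG.norm_conv_le hr hf' (g := g - g') hgg x
  linarith

theorem norm_invol_le (hG : IsEnvelope G K) {f : Space d → ℂ} {r : ℝ}
    (hf : ∀ x, ‖f x‖ ≤ r * G x) (x : Space d) : ‖invol f x‖ ≤ r * G x := by
  rw [invol, RCLike.norm_conj, ← hG.even]; exact hf _

theorem norm_invol_sub_le (hG : IsEnvelope G K) {f g : Space d → ℂ} {r : ℝ}
    (hf : ∀ x, ‖f x - g x‖ ≤ r * G x) (x : Space d) : ‖invol f x - invol g x‖ ≤ r * G x := by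
  rw [invol, invol, ← map_sub, RCLike.norm_conj, ← hG.even]; exact hf _

theorem continuous_invol {f : ℝ → Space d → ℂ} (hfc : Continuous (Function.uncurry f)) :
    Continuous (Function.uncurry fun t => invol (f t)) :=
  Complex.continuous_conj.comp
    (hfc.comp (f := fun z : ℝ × Space d => (z.1, -z.2)) (by fun_prop))

theorem nonneg_of_norm_le (hG : IsEnvelope G K) {f : Space d → ℂ} {r : ℝ}
    (hf : ∀ x, ‖f x‖ ≤ r * G x) : 0 ≤ r :=
  nonneg_of_mul_nonneg_left ((norm_nonneg _).trans (hf 0)) (hG.pos 0)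

theorem norm_convPow_le (hG : IsEnvelope G K) {f : Space d → ℂ} {r : ℝ}
    (hf : ∀ x, ‖f x‖ ≤ r * G x) (k : ℕ) (x : Space d) :
    ‖convPow k f x‖ ≤ (r * K) ^ (2 * k) * r * G x := by
  have hr := hG.nonneg_of_norm_le hf
  have hK := hG.K_nonneg
  induction k generalizing x with
  | zero => simpa [convPow] using hf x
  | succ k ih =>
    have := hG.norm_conv_le (r := K * r * r) (by positivity)
      (hG.norm_conv_le hr hf (hG.norm_invol_le hf)) ih x
    refine this.trans (le_of_eq ?_)
    ring

theorem continuous_convPow (hG : IsEnvelope G K) {f : ℝ → Space d → ℂ} {r : ℝ}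
    (hfc : Continuous (Function.uncurry f)) (hf : ∀ t x, ‖f t x‖ ≤ r * G x) (k : ℕ) :
    Continuous (Function.uncurry fun t => convPow k (f t)) := by
  have hr := hG.nonneg_of_norm_le (hf 0)
  have hK := hG.K_nonneg
  induction k with
  | zero => exact hfc
  | succ k ih =>
    exact hG.continuous_conv (r := K * r * r) (by positivity)
      (hG.continuous_conv hr hfc (continuous_invol hfc) hf fun t => hG.norm_invol_le (hf t)) ih
      (fun t => hG.norm_conv_le hr (hf t) (hG.norm_invol_le (hf t)))
      (fun t => hG.norm_convPow_le (hf t) k)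

theorem continuous_convPow_apply (hG : IsEnvelope G K) {f : Space d → ℂ} {r : ℝ}
    (hfc : Continuous f) (hf : ∀ x, ‖f x‖ ≤ r * G x) (k : ℕ) : Continuous (convPow k f) :=
  (hG.continuous_convPow (f := fun _ => f) (hfc.comp continuous_snd) (fun _ => hf) k).comp
    (f := fun x => ((0 : ℝ), x)) (by fun_prop)

theorem norm_convPow_sub_le (hG : IsEnvelope G K) {f g : Space d → ℂ} {r a : ℝ} (ha : 0 ≤ a)
    (hfc : Continuous f) (hgc : Continuous g)
    (hf : ∀ x, ‖f x‖ ≤ r * G x) (hg : ∀ x, ‖g x‖ ≤ r * G x)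
    (hfg : ∀ x, ‖f x - g x‖ ≤ a * G x) (k : ℕ) (x : Space d) :
    ‖convPow k f x - convPow k g x‖ ≤ (2 * k + 1) * (r * K) ^ (2 * k) * a * G x := by
  have hr := hG.nonneg_of_norm_le hf
  have hK := hG.K_nonneg
  have hic : ∀ {h : Space d → ℂ}, Continuous h → Continuous (invol h) := fun hh =>
    Complex.continuous_conj.comp (hh.comp continuous_neg)
  have hsq : ∀ {h : Space d → ℂ}, Continuous h → (∀ x, ‖h x‖ ≤ r * G x) →
      Continuous (conv h (invol h)) := fun {h} hh hhr =>
    (hG.continuous_conv (f := fun _ => h) (g := fun _ => invol h) hr (hh.comp continuous_snd)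
      ((hic hh).comp continuous_snd) (fun _ => hhr) (fun _ => hG.norm_invol_le hhr)).comp
      (f := fun x => ((0 : ℝ), x)) (by fun_prop)
  induction k generalizing x with
  | zero => simpa [convPow] using hfg x
  | succ k ih =>
    have h1 := hG.norm_conv_sub_le hr ha hfc (hic hfc) hgc (hic hgc) (hG.norm_invol_le hf) hg hfg
      (hG.norm_invol_sub_le hfg)
    have h2 := hG.norm_conv_sub_le (f := conv f (invol f)) (f' := conv g (invol g))
      (g := convPow k f) (g' := convPow k g)
      (r := K * r * r) (a := K * (a * r + r * a)) (by positivity)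
      (by positivity) (hsq hfc hf) (hG.continuous_convPow_apply hfc hf k) (hsq hgc hg)
      (hG.continuous_convPow_apply hgc hg k) (hG.norm_convPow_le hf k)
      (hG.norm_conv_le hr hg (hG.norm_invol_le hg)) h1 ih x
    refine h2.trans (le_of_eq ?_)
    push_cast
    ring

theorem integrable_of_norm_le (hG : IsEnvelope G K) {f : Space d → ℂ} {r : ℝ}
    (hfc : Continuous f) (hf : ∀ x, ‖f x‖ ≤ r * G x) : Integrable f :=
  (hG.integrable.const_mul r).mono' hfc.aestronglyMeasurable (Eventually.of_forall hf)

theorem memLp_two (hG : IsEnvelope G K) : MemLp G 2 := by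
  rw [memLp_two_iff_integrable_sq hG.continuous.aestronglyMeasurable]
  refine hG.integrable.mono' (hG.continuous.pow 2).aestronglyMeasurable
    (Eventually.of_forall fun y => ?_)
  rw [Real.norm_of_nonneg (sq_nonneg _), sq]
  exact mul_le_of_le_one_right (hG.pos _).le (hG.le_one _)

theorem memLp_two_of_norm_le (hG : IsEnvelope G K) {f : Space d → ℂ} {r : ℝ}
    (hfc : Continuous f) (hf : ∀ x, ‖f x‖ ≤ r * G x) : MemLp f 2 :=
  (hG.memLp_two.const_mul r).of_le hfc.aestronglyMeasurable
    (Eventually.of_forall fun x => (hf x).trans (Real.le_norm_self _))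

end IsEnvelope

/-! ### Inverse Fourier transforms of convolution powers -/

theorem conv_eq_convolution {d : ℕ} (f g : Space d → ℂ) :
    conv f g = convolution f g (ContinuousLinearMap.mul ℂ ℂ) volume := rfl

theorem fourierInv_conv {d : ℕ} {f g : Space d → ℂ} (hf : Integrable f) (hg : Integrable g)
    (x : Space d) : (𝓕⁻ (conv f g)) x = (𝓕⁻ f) x * (𝓕⁻ g) x := by
  rw [conv_eq_convolution]
  simp only [Real.fourierInv_eq_fourier_neg]
  exact Real.fourier_mul_convolution_eq hf hg (-x)

theorem fourierInv_invol {d : ℕ} (f : Space d → ℂ) (x : Space d) :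
    (𝓕⁻ (invol f)) x = (starRingEnd ℂ) ((𝓕⁻ f) x) := by
  rw [Real.fourierInv_eq', Real.fourierInv_eq', ← integral_conj, ← integral_neg_eq_self]
  refine integral_congr_ae (Eventually.of_forall fun y => ?_)
  simp only [invol, smul_eq_mul, map_mul, neg_neg, ← Complex.exp_conj, inner_neg_left,
    Complex.conj_ofReal, Complex.conj_I]
  congr 2
  push_cast
  ring

theorem IsEnvelope.fourierInv_convPow {d : ℕ} {G : Space d → ℝ} {K : ℝ} (hG : IsEnvelope G K)
    {f : Space d → ℂ} {r : ℝ} (hfc : Continuous f) (hf : ∀ x, ‖f x‖ ≤ r * G x) (k : ℕ)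
    (x : Space d) :
    (𝓕⁻ (convPow k f)) x = ((‖(𝓕⁻ f) x‖ ^ (2 * k) : ℝ) : ℂ) * (𝓕⁻ f) x := by
  have hi := hG.integrable_of_norm_le hfc hf
  have hii : Integrable (invol f) := hG.integrable_of_norm_le
    (Complex.continuous_conj.comp (hfc.comp continuous_neg)) (hG.norm_invol_le hf)
  have hq : Integrable (conv f (invol f)) := hi.integrable_convolution (.mul ℂ ℂ) hii
  induction k with
  | zero => simp [convPow]
  | succ k ih =>
    rw [convPow, fourierInv_conv hq (hG.integrable_of_norm_le
      (hG.continuous_convPow_apply hfc hf k) (hG.norm_convPow_le hf k)), ih,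
      fourierInv_conv hi hii, fourierInv_invol, Complex.mul_conj, Complex.normSq_eq_norm_sq]
    push_cast
    ring

/-! ### The integral equation on the Fourier side -/

/-- The symbol `e^{-i(t/2)|ξ|²}` of the Schrödinger propagator, in the variable `ζ = ξ / 2π`. -/
def phase {d : ℕ} (t : ℝ) (ζ : Space d) : ℂ :=
  Complex.exp (-Complex.I * ((t / 2 * ‖(2 * Real.pi) • ζ‖ ^ 2 : ℝ) : ℂ))

theorem phase_eq {d : ℕ} (t : ℝ) (ζ : Space d) :
    phase t ζ = Complex.exp (Complex.I * ((-(t / 2 * ‖(2 * Real.pi) • ζ‖ ^ 2) : ℝ) : ℂ)) := by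
  rw [phase]; push_cast; ring_nf

theorem norm_phase {d : ℕ} (t : ℝ) (ζ : Space d) : ‖phase t ζ‖ = 1 := by
  rw [phase_eq, mul_comm, Complex.norm_exp_ofReal_mul_I]

@[fun_prop]
theorem continuous_phase {d : ℕ} : Continuous fun z : ℝ × Space d => phase z.1 z.2 := by
  unfold phase; fun_prop

theorem norm_phase_sub_one_le {d : ℕ} (t : ℝ) (ζ : Space d) :
    ‖phase t ζ - 1‖ ≤ 2 * Real.pi ^ 2 * |t| * ‖ζ‖ ^ 2 := by
  rw [phase_eq]
  refine (Real.norm_exp_I_mul_ofReal_sub_one_le).trans (le_of_eq ?_)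
  rw [norm_neg, norm_smul, Real.norm_eq_abs, Real.norm_of_nonneg (by positivity), abs_mul, abs_div,
    abs_of_nonneg (by positivity : (0 : ℝ) ≤ (2 * Real.pi * ‖ζ‖) ^ 2)]
  norm_num
  ring

/-- The right-hand side of the integral equation on the Fourier side. -/
def duhamelMap {d : ℕ} (σ : ℕ) (μ : ℝ) (u₀ : Space d → ℂ) (u : ℝ → Space d → ℂ) (t : ℝ)
    (x : Space d) : ℂ :=
  phase t x * u₀ x -
    (Complex.I * (μ : ℂ)) * ∫ τ in (0 : ℝ)..t, phase (t - τ) x * convPow σ (u τ) x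

namespace IsEnvelope

variable {d : ℕ} {G : Space d → ℝ} {K : ℝ}

theorem continuous_integrand (hG : IsEnvelope G K) (σ : ℕ) {u : ℝ → Space d → ℂ} {r : ℝ}
    (huc : Continuous (Function.uncurry u)) (hu : ∀ t x, ‖u t x‖ ≤ r * G x) :
    Continuous fun z : (ℝ × Space d) × ℝ =>
      phase (z.1.1 - z.2) z.1.2 * convPow σ (u z.2) z.1.2 := by
  have h1 := hG.continuous_convPow huc hu σ
  have h2 : Continuous fun z : (ℝ × Space d) × ℝ => convPow σ (u z.2) z.1.2 :=
    h1.comp (f := fun z : (ℝ × Space d) × ℝ => (z.2, z.1.2)) (by fun_prop)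
  have h3 : Continuous fun z : (ℝ × Space d) × ℝ => phase (z.1.1 - z.2) z.1.2 :=
    continuous_phase.comp (f := fun z : (ℝ × Space d) × ℝ => (z.1.1 - z.2, z.1.2)) (by fun_prop)
  exact h3.mul h2

theorem continuous_duhamelMap (hG : IsEnvelope G K) (σ : ℕ) (μ : ℝ) {u₀ : Space d → ℂ}
    (hu₀ : Continuous u₀) {u : ℝ → Space d → ℂ} {r : ℝ}
    (huc : Continuous (Function.uncurry u)) (hu : ∀ t x, ‖u t x‖ ≤ r * G x) :
    Continuous fun z : ℝ × Space d => duhamelMap σ μ u₀ u z.1 z.2 := by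
  have h := hG.continuous_integrand σ huc hu
  have := intervalIntegral.continuous_parametric_intervalIntegral_of_continuous (μ := volume)
    (f := fun (z : ℝ × Space d) τ => phase (z.1 - τ) z.2 * convPow σ (u τ) z.2) (a₀ := 0)
    h (s := Prod.fst) continuous_fst
  unfold duhamelMap
  exact (continuous_phase.mul (hu₀.comp continuous_snd)).sub (continuous_const.mul this)

theorem norm_integral_integrand_le (hG : IsEnvelope G K) (σ : ℕ) {u : ℝ → Space d → ℂ} {r : ℝ}
    (hu : ∀ t x, ‖u t x‖ ≤ r * G x) {t : ℝ} (ht : 0 ≤ t) (x : Space d) :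
    ‖∫ τ in (0 : ℝ)..t, phase (t - τ) x * convPow σ (u τ) x‖ ≤
      t * (r * K) ^ (2 * σ) * r * G x := by
  refine (intervalIntegral.norm_integral_le_of_norm_le_const
    (C := (r * K) ^ (2 * σ) * r * G x) fun τ _ => ?_).trans (le_of_eq ?_)
  · rw [norm_mul, norm_phase, one_mul]
    exact hG.norm_convPow_le (hu τ) σ x
  · rw [sub_zero, abs_of_nonneg ht]; ring

theorem norm_duhamelMap_le (hG : IsEnvelope G K) (σ : ℕ) {μ : ℝ} (hμ : |μ| ≤ 1)
    {u₀ : Space d → ℂ} {r₀ : ℝ} (hu₀ : ∀ x, ‖u₀ x‖ ≤ r₀ * G x) {u : ℝ → Space d → ℂ} {r : ℝ}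
    (hu : ∀ t x, ‖u t x‖ ≤ r * G x) {t : ℝ} (ht : 0 ≤ t) (x : Space d) :
    ‖duhamelMap σ μ u₀ u t x‖ ≤ (r₀ + t * (r * K) ^ (2 * σ) * r) * G x := by
  have h1 := hG.norm_integral_integrand_le σ hu ht x
  have h2 : ‖(Complex.I * (μ : ℂ)) * ∫ τ in (0 : ℝ)..t, phase (t - τ) x * convPow σ (u τ) x‖ ≤
      t * (r * K) ^ (2 * σ) * r * G x := by
    rw [norm_mul, norm_mul, Complex.norm_I, one_mul, Complex.norm_real, Real.norm_eq_abs]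
    exact (mul_le_of_le_one_left (norm_nonneg _) hμ).trans h1
  refine (norm_sub_le _ _).trans ?_
  rw [norm_mul, norm_phase, one_mul]
  linarith [hu₀ x]

theorem norm_duhamelMap_sub_le (hG : IsEnvelope G K) (σ : ℕ) {μ : ℝ} (hμ : |μ| ≤ 1)
    {u₀ : Space d → ℂ} {u v : ℝ → Space d → ℂ} {r a : ℝ} (ha : 0 ≤ a)
    (huc : Continuous (Function.uncurry u)) (hu : ∀ t x, ‖u t x‖ ≤ r * G x)
    (hvc : Continuous (Function.uncurry v)) (hv : ∀ t x, ‖v t x‖ ≤ r * G x)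
    (huv : ∀ t x, ‖u t x - v t x‖ ≤ a * G x) {t : ℝ} (ht : 0 ≤ t) (x : Space d) :
    ‖duhamelMap σ μ u₀ u t x - duhamelMap σ μ u₀ v t x‖ ≤
      t * ((2 * σ + 1) * (r * K) ^ (2 * σ) * a) * G x := by
  have hint : ∀ {w : ℝ → Space d → ℂ}, Continuous (Function.uncurry w) →
      (∀ t x, ‖w t x‖ ≤ r * G x) →
      IntervalIntegrable (fun τ => phase (t - τ) x * convPow σ (w τ) x) volume 0 t :=
    fun hwc hw => ((hG.continuous_integrand σ hwc hw).comp
      (f := fun τ : ℝ => ((t, x), τ)) (by fun_prop)).intervalIntegrable _ _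
  have hcu : ∀ {w : ℝ → Space d → ℂ}, Continuous (Function.uncurry w) → ∀ t, Continuous (w t) :=
    fun hwc t => hwc.comp (f := fun x => (t, x)) (by fun_prop)
  have h : duhamelMap σ μ u₀ u t x - duhamelMap σ μ u₀ v t x = -((Complex.I * (μ : ℂ)) *
      ∫ τ in (0 : ℝ)..t, phase (t - τ) x * (convPow σ (u τ) x - convPow σ (v τ) x)) := by
    simp only [mul_sub, duhamelMap]
    rw [intervalIntegral.integral_sub (hint huc hu) (hint hvc hv)]
    ring
  rw [h, norm_neg, norm_mul, norm_mul, Complex.norm_I, one_mul, Complex.norm_real,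
    Real.norm_eq_abs]
  refine (mul_le_of_le_one_left (norm_nonneg _) hμ).trans ?_
  refine (intervalIntegral.norm_integral_le_of_norm_le_const
    (C := (2 * σ + 1) * (r * K) ^ (2 * σ) * a * G x) fun τ _ => ?_).trans (le_of_eq ?_)
  · rw [norm_mul, norm_phase, one_mul]
    exact hG.norm_convPow_sub_le ha (hcu huc τ) (hcu hvc τ) (hu τ) (hv τ) (huv τ) σ x
  · rw [sub_zero, abs_of_nonneg ht]; ring

/-- Existence for the integral equation on the Fourier side. The fixed point argument runs in the
space of bounded continuous functions of `(t, x)`, applied to the quotient of the unknown by the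
envelope; the time variable is clamped to `[0, T]`. -/
theorem exists_eq_duhamelMap (hG : IsEnvelope G K) (σ : ℕ) {μ : ℝ} (hμ : |μ| ≤ 1)
    {u₀ : Space d → ℂ} (hu₀c : Continuous u₀) {r₀ : ℝ} (hu₀ : ∀ x, ‖u₀ x‖ ≤ r₀ * G x)
    {T : ℝ} (hT : 0 ≤ T) (hsmall : (2 * σ + 1) * (T * (2 * r₀ * K) ^ (2 * σ)) ≤ 1 / 2) :
    ∃ u : ℝ → Space d → ℂ, Continuous (Function.uncurry u) ∧ (∀ t x, ‖u t x‖ ≤ 2 * r₀ * G x) ∧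
      ∀ t ∈ Set.Icc 0 T, ∀ x, u t x = duhamelMap σ μ u₀ u t x := by
  have hr₀ := hG.nonneg_of_norm_le hu₀
  have hK := hG.K_nonneg
  have hGc := hG.continuous
  -- clamping the time makes the Duhamel map act on functions of all `t ∈ ℝ`
  let c : ℝ → ℝ := fun t => max 0 (min t T)
  have hc0 : ∀ t, 0 ≤ c t := fun t => le_max_left _ _
  have hcT : ∀ t, c t ≤ T := fun t => max_le hT (min_le_right _ _)
  have hcid : ∀ t ∈ Set.Icc 0 T, c t = t := fun t ht => by
    simp [c, min_eq_left ht.2, max_eq_right ht.1]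
  have hcc : Continuous c := by fun_prop
  let B := Metric.closedBall (0 : (ℝ × Space d) →ᵇ ℂ) (2 * r₀)
  let U : B → ℝ → Space d → ℂ := fun h t x => (h : (ℝ × Space d) →ᵇ ℂ) (t, x) * (G x : ℂ)
  have hUc : ∀ h, Continuous (Function.uncurry (U h)) := fun h => by
    have := h.1.continuous
    change Continuous fun z : ℝ × Space d => h.1 z * (G z.2 : ℂ)
    fun_prop
  have hnG : ∀ x, ‖(G x : ℂ)‖ = G x := fun x => by
    rw [Complex.norm_real, Real.norm_of_nonneg (hG.pos x).le]
  have hU : ∀ h t x, ‖U h t x‖ ≤ 2 * r₀ * G x := fun h t x => by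
    rw [norm_mul, hnG]
    have : ‖h.1‖ ≤ 2 * r₀ := mem_closedBall_zero_iff.1 h.2
    exact mul_le_mul_of_nonneg_right ((h.1.norm_coe_le_norm _).trans this) (hG.pos x).le
  have hUU : ∀ h k t x, ‖U h t x - U k t x‖ ≤ dist h k * G x := fun h k t x => by
    rw [← sub_mul, norm_mul, hnG, ← dist_eq_norm]
    exact mul_le_mul_of_nonneg_right (BoundedContinuousFunction.dist_coe_le_dist _) (hG.pos x).le
  have hF : ∀ h (z : ℝ × Space d),
      ‖duhamelMap σ μ u₀ (U h) (c z.1) z.2 / (G z.2 : ℂ)‖ ≤ 2 * r₀ := fun h z => by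
    rw [norm_div, hnG, div_le_iff₀ (hG.pos _)]
    refine (hG.norm_duhamelMap_le σ hμ hu₀ (hU h) (hc0 _) z.2).trans ?_
    refine mul_le_mul_of_nonneg_right ?_ (hG.pos _).le
    have h1 : c z.1 * (2 * r₀ * K) ^ (2 * σ) ≤ 1 / 2 := by
      calc _ ≤ T * (2 * r₀ * K) ^ (2 * σ) := by gcongr; exact hcT _
        _ ≤ (2 * σ + 1) * (T * (2 * r₀ * K) ^ (2 * σ)) :=
            le_mul_of_one_le_left (by positivity) (by linarith [Nat.cast_nonneg (α := ℝ) σ])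
        _ ≤ _ := hsmall
    nlinarith
  let F : B → B := fun h => ⟨BoundedContinuousFunction.ofNormedAddCommGroup
    (fun z : ℝ × Space d => duhamelMap σ μ u₀ (U h) (c z.1) z.2 / (G z.2 : ℂ))
    (by
      have h1 := (hG.continuous_duhamelMap σ μ hu₀c (hUc h) (hU h)).comp
        (f := fun z : ℝ × Space d => (c z.1, z.2)) (by fun_prop)
      exact h1.div (by fun_prop) fun z => by exact_mod_cast (hG.pos _).ne')
    (2 * r₀) (hF h), by
      rw [mem_closedBall_zero_iff]
      exact BoundedContinuousFunction.norm_ofNormedAddCommGroup_le _ (by positivity) (hF h)⟩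
  have hcontr : ContractingWith (1 / 2) F := by
    refine ⟨by norm_num, LipschitzWith.of_dist_le_mul fun h k => ?_⟩
    rw [Subtype.dist_eq, BoundedContinuousFunction.dist_le (by positivity)]
    intro z
    change dist (duhamelMap σ μ u₀ (U h) (c z.1) z.2 / (G z.2 : ℂ))
      (duhamelMap σ μ u₀ (U k) (c z.1) z.2 / (G z.2 : ℂ)) ≤ _
    rw [dist_eq_norm, ← sub_div, norm_div, hnG, div_le_iff₀ (hG.pos _)]
    refine (hG.norm_duhamelMap_sub_le σ hμ dist_nonneg (hUc h) (hU h) (hUc k) (hU k) (hUU h k)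
      (hc0 _) z.2).trans ?_
    refine mul_le_mul_of_nonneg_right ?_ (hG.pos _).le
    calc c z.1 * ((2 * σ + 1) * (2 * r₀ * K) ^ (2 * σ) * dist h k)
        ≤ T * ((2 * σ + 1) * (2 * r₀ * K) ^ (2 * σ) * dist h k) := by gcongr; exact hcT _
      _ = (2 * σ + 1) * (T * (2 * r₀ * K) ^ (2 * σ)) * dist h k := by ring
      _ ≤ 1 / 2 * dist h k := by gcongr
      _ = _ := by norm_num
  have : CompleteSpace B := (Metric.isClosed_closedBall).completeSpace_coe
  have : Nonempty B := ⟨⟨0, by simp [B, hr₀]⟩⟩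
  have hfix := hcontr.fixedPoint_isFixedPt
  set h := ContractingWith.fixedPoint F hcontr
  refine ⟨U h, hUc h, hU h, fun t ht x => ?_⟩
  have h1 : h.1 (t, x) = duhamelMap σ μ u₀ (U h) (c t) x / (G x : ℂ) := by
    conv_lhs => rw [← hfix.eq]
    rfl
  have hGx : (G x : ℂ) ≠ 0 := by exact_mod_cast (hG.pos x).ne'
  change h.1 (t, x) * (G x : ℂ) = _
  rw [h1, hcid t ht, div_mul_cancel₀ _ hGx]

end IsEnvelope

/-! ### From the Fourier side to solutions in `L²` -/

/-- Dominated convergence in `L²`. -/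
theorem tendsto_eLpNorm_two_zero {ι α : Type*} [MeasurableSpace α] {ν : Measure α} {l : Filter ι}
    [l.IsCountablyGenerated] {f : ι → α → ℂ} {H : α → ℝ} (hH : MemLp H 2 ν)
    (hfm : ∀ i, AEStronglyMeasurable (f i) ν) (hf : ∀ i x, ‖f i x‖ ≤ H x)
    (hlim : ∀ x, Tendsto (fun i => f i x) l (𝓝 0)) :
    Tendsto (fun i => eLpNorm (f i) 2 ν) l (𝓝 0) := by
  have h2 : (2 : ℝ≥0∞) ≠ 0 := by norm_num
  have h2' : (2 : ℝ≥0∞) ≠ ∞ := by norm_num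
  simp only [eLpNorm_eq_lintegral_rpow_enorm_toReal h2 h2']
  have hfin : ∫⁻ x, ‖H x‖ₑ ^ (2 : ℝ≥0∞).toReal ∂ν ≠ ∞ :=
    (lintegral_rpow_enorm_lt_top_of_eLpNorm_lt_top h2 h2' hH.2).ne
  have key : Tendsto (fun i => ∫⁻ x, ‖f i x‖ₑ ^ (2 : ℝ≥0∞).toReal ∂ν) l
      (𝓝 (∫⁻ _, 0 ∂ν)) := by
    refine tendsto_lintegral_filter_of_dominated_convergence' _
      (Eventually.of_forall fun i => (hfm i).enorm.pow_const _)
      (Eventually.of_forall fun i => Eventually.of_forall fun x => ?_) hfin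
      (Eventually.of_forall fun x => ?_)
    · gcongr
      rw [enorm_le_iff_norm_le]
      exact (hf i x).trans (Real.le_norm_self _)
    · have h := ((hlim x).enorm).ennrpow_const (2 : ℝ≥0∞).toReal
      simpa using h
  have := key.ennrpow_const (1 / (2 : ℝ≥0∞).toReal)
  simpa using this

theorem norm_le_of_mem_unitCube {d : ℕ} {n : Fin d → ℤ} {x y : Space d} (hx : x ∈ unitCube n)
    (hy : y ∈ unitCube n) : ‖x - y‖ ≤ √d := by
  rw [EuclideanSpace.norm_eq]
  refine Real.sqrt_le_sqrt ?_
  calc ∑ i, ‖(x - y) i‖ ^ 2 ≤ ∑ _i : Fin d, (1 : ℝ) := by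
        refine Finset.sum_le_sum fun i _ => ?_
        have h1 := hx i
        have h2 := hy i
        have h3 : ‖(x - y) i‖ ≤ 1 := by
          rw [PiLp.sub_apply, Real.norm_eq_abs, abs_le]
          constructor <;> linarith
        nlinarith [norm_nonneg ((x - y) i)]
    _ = d := by simp

theorem pairwise_disjoint_unitCube (d : ℕ) :
    Pairwise (Function.onFun Disjoint fun n : Fin d → ℤ => (unitCube n : Set (Space d))) := by
  intro m n hmn
  refine Set.disjoint_left.2 fun x hx hy => hmn (funext fun j => ?_)
  have h1 := hx j
  have h2 := hy j
  have h3 : (m j : ℝ) < n j + 1 := by linarith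
  have h4 : (n j : ℝ) < m j + 1 := by linarith
  have h3' : m j < n j + 1 := by exact_mod_cast h3
  have h4' : n j < m j + 1 := by exact_mod_cast h4
  omega

theorem norm_rescale_le {d : ℕ} (f : Space d → ℂ) (ξ : Space d) :
    ‖rescale f ξ‖ ≤ ‖f ((2 * Real.pi)⁻¹ • ξ)‖ := by
  rw [rescale, norm_mul]
  refine mul_le_of_le_one_left (norm_nonneg _) ?_
  rw [norm_inv, Complex.norm_real, Real.norm_of_nonneg (by positivity)]
  exact inv_le_one_of_one_le₀ (one_le_pow₀ (by nlinarith [Real.pi_gt_three]))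

/-- The `L²` function with a given Mathlib Fourier transform. -/
def ofFourier {d : ℕ} (f : Space d → ℂ) (hf : MemLp f 2) : L2 d := 𝓕⁻ (hf.toLp f : L2 d)

theorem ofFourier_congr {d : ℕ} {f g : Space d → ℂ} (hf : MemLp f 2) (hg : MemLp g 2)
    (h : f =ᵐ[volume] g) : ofFourier f hf = ofFourier g hg := by
  rw [ofFourier, ofFourier, (MemLp.toLp_eq_toLp_iff hf hg).2 h]

theorem fourier_ofFourier {d : ℕ} {f : Space d → ℂ} (hf : MemLp f 2) :
    𝓕 (ofFourier f hf) = (hf.toLp f : L2 d) := FourierTransform.fourier_fourierInv_eq _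

theorem ofFourier_sub {d : ℕ} {f g : Space d → ℂ} (hf : MemLp f 2) (hg : MemLp g 2) :
    ofFourier (f - g) (hf.sub hg) = ofFourier f hf - ofFourier g hg := by
  have : (hf.sub hg).toLp (f - g) = (hf.toLp f : L2 d) - hg.toLp g := rfl
  rw [ofFourier, this]
  exact map_sub (Lp.fourierTransformₗᵢ (Space d) ℂ).symm _ _

theorem ofFourier_const_mul {d : ℕ} (c : ℂ) {f : Space d → ℂ} (hf : MemLp f 2) :
    ofFourier (fun x => c * f x) (hf.const_mul c) = c • ofFourier f hf := by
  have : (hf.const_mul c).toLp (fun x => c * f x) = c • (hf.toLp f : L2 d) := rfl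
  rw [ofFourier, this]
  exact map_smul (Lp.fourierTransformₗᵢ (Space d) ℂ).symm _ _

theorem memLp_phase_mul {d : ℕ} {f : Space d → ℂ} (hf : MemLp f 2) (t : ℝ) :
    MemLp (fun x => phase t x * f x) 2 := by
  refine hf.of_le (AEStronglyMeasurable.mul ?_ hf.1) (Eventually.of_forall fun x => ?_)
  · exact (continuous_phase.comp (f := fun x => (t, x)) (by fun_prop)).aestronglyMeasurable
  · rw [norm_mul, norm_phase, one_mul]

theorem schrodinger_ofFourier {d : ℕ} {f : Space d → ℂ} (hf : MemLp f 2) (t : ℝ) :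
    schrodinger t (ofFourier f hf) = ofFourier _ (memLp_phase_mul hf t) := by
  refine ofFourier_congr _ _ ?_
  rw [fourier_ofFourier]
  filter_upwards [hf.coeFn_toLp] with x hx
  rw [hx, phase]

theorem mNorm_ofFourier {d : ℕ} {f : Space d → ℂ} (hf : MemLp f 2) : mNorm (ofFourier f hf) =
    ∑' n : Fin d → ℤ, eLpNorm (rescale f) 2 (volume.restrict (unitCube n)) := by
  rw [mNorm_eq_rescale, fourier_ofFourier]
  exact tsum_congr fun n => eLpNorm_congr_ae
    (ae_restrict_of_ae (rescale_congr_ae hf.coeFn_toLp))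

theorem hasFourierDensity_ofFourier {d : ℕ} {f : Space d → ℂ} (hf : MemLp f 2) :
    HasFourierDensity (ofFourier f hf : 𝓢'(Space d, ℂ)) (rescale f) := by
  have h := hasFourierDensity_rescale (ofFourier f hf)
  rw [fourier_ofFourier] at h
  have hae : rescale (hf.toLp f : L2 d) =ᵐ[volume] rescale f := rescale_congr_ae hf.coeFn_toLp
  refine ⟨h.1.congr hae, fun φ => ⟨(h.2 φ).1.congr ?_, (h.2 φ).2.trans (integral_congr_ae ?_)⟩⟩ <;>
  · filter_upwards [hae] with x hx
    rw [hx]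

namespace IsEnvelope

variable {d : ℕ} {G : Space d → ℝ} {K : ℝ}

/-- The norm of `M` is finite on the multiples of an envelope, as an envelope is comparable to a
constant on each unit cube. -/
theorem tsum_eLpNorm_lt_top (hG : IsEnvelope G K) : ∑' n : Fin d → ℤ,
    eLpNorm (fun ξ : Space d => G ((2 * Real.pi)⁻¹ • ξ)) 2 (volume.restrict (unitCube n)) < ∞ := by
  have hpi : (2 * Real.pi)⁻¹ ≠ 0 := by positivity
  obtain ⟨C, hC, hslow⟩ := hG.slow ((2 * Real.pi)⁻¹ * √d)
  set H : Space d → ℝ := fun ξ => G ((2 * Real.pi)⁻¹ • ξ) with hH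
  have hHi : Integrable H := hG.integrable.comp_smul hpi
  have hHs : ∀ n : Fin d → ℤ, ∀ x ∈ (unitCube n : Set (Space d)),
      ∀ y ∈ (unitCube n : Set (Space d)), H x ≤ C * H y := fun n x hx y hy => by
    refine hslow _ _ ?_
    rw [← smul_sub, norm_smul, Real.norm_of_nonneg (by positivity)]
    exact mul_le_mul_of_nonneg_left (norm_le_of_mem_unitCube hx hy) (by positivity)
  have hbound : ∀ n : Fin d → ℤ, eLpNorm H 2 (volume.restrict (unitCube n)) ≤
      ∫⁻ y in unitCube n, ENNReal.ofReal (C * H y) := fun n => by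
    have hv : (volume.restrict (unitCube n : Set (Space d))) Set.univ = 1 := by
      rw [Measure.restrict_apply_univ, volume_unitCube]
    obtain ⟨z, hz⟩ : (unitCube n : Set (Space d)).Nonempty :=
      nonempty_of_measure_ne_zero (μ := volume) (by rw [volume_unitCube]; norm_num)
    -- `H ≤ B` on the cube, and `B` is at most the mean of `C H` over the cube
    set B : ℝ := ⨅ y : (unitCube n : Set (Space d)), C * H y
    have hne : Nonempty (unitCube n : Set (Space d)) := ⟨⟨z, hz⟩⟩
    have hbdd : BddBelow (Set.range fun y : (unitCube n : Set (Space d)) => C * H y) :=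
      ⟨0, by rintro _ ⟨y, rfl⟩; exact mul_nonneg hC (hG.pos _).le⟩
    have h1 : eLpNorm H 2 (volume.restrict (unitCube n)) ≤ ENNReal.ofReal B := by
      refine (eLpNorm_le_of_ae_bound (C := B) ?_).trans (by rw [hv]; simp)
      filter_upwards [ae_restrict_mem (measurableSet_unitCube n)] with x hx
      rw [Real.norm_of_nonneg (hG.pos _).le]
      exact le_ciInf fun y => hHs n x hx y y.2
    refine h1.trans ?_
    calc ENNReal.ofReal B = ∫⁻ _ in (unitCube n : Set (Space d)), ENNReal.ofReal B := by
          rw [lintegral_const, hv, mul_one]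
      _ ≤ _ := by
        refine setLIntegral_mono' (measurableSet_unitCube n) fun y hy => ?_
        exact ENNReal.ofReal_le_ofReal (ciInf_le hbdd ⟨y, hy⟩)
  refine (ENNReal.tsum_le_tsum hbound).trans_lt ?_
  rw [← lintegral_iUnion measurableSet_unitCube (pairwise_disjoint_unitCube d), iUnion_unitCube,
    Measure.restrict_univ]
  exact (hHi.const_mul C).lintegral_lt_top

theorem memLp_rescaled (hG : IsEnvelope G K) :
    MemLp (fun ξ : Space d => G ((2 * Real.pi)⁻¹ • ξ)) 2 := by
  have hpi : (2 * Real.pi)⁻¹ ≠ 0 := by positivity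
  have hGc := hG.continuous
  rw [memLp_two_iff_integrable_sq (by fun_prop)]
  exact ((memLp_two_iff_integrable_sq hG.continuous.aestronglyMeasurable).1
    hG.memLp_two).comp_smul hpi

theorem mNorm_ofFourier_lt_top (hG : IsEnvelope G K) {f : Space d → ℂ} {r : ℝ}
    (hf : ∀ x, ‖f x‖ ≤ r * G x) (hm : MemLp f 2) : mNorm (ofFourier f hm) < ∞ := by
  rw [mNorm_ofFourier]
  calc _ ≤ ∑' n : Fin d → ℤ, ENNReal.ofReal r * eLpNorm (fun ξ : Space d =>
        G ((2 * Real.pi)⁻¹ • ξ)) 2 (volume.restrict (unitCube n)) := by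
        refine ENNReal.tsum_le_tsum fun n => ?_
        refine eLpNorm_le_mul_eLpNorm_of_ae_le_mul (Eventually.of_forall fun ξ => ?_) 2
        rw [Real.norm_of_nonneg (hG.pos _).le]
        exact (norm_rescale_le f ξ).trans (hf _)
    _ < ∞ := by
      rw [ENNReal.tsum_mul_left]
      exact ENNReal.mul_lt_top ENNReal.ofReal_lt_top hG.tsum_eLpNorm_lt_top

theorem tendsto_mNorm_ofFourier (hG : IsEnvelope G K) {ι : Type*} {l : Filter ι}
    [l.IsCountablyGenerated] {f : ι → Space d → ℂ} {r : ℝ} (hf : ∀ i x, ‖f i x‖ ≤ r * G x)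
    (hm : ∀ i, MemLp (f i) 2) (hlim : ∀ x, Tendsto (fun i => f i x) l (𝓝 0)) :
    Tendsto (fun i => mNorm (ofFourier (f i) (hm i))) l (𝓝 0) := by
  simp only [mNorm_ofFourier, ← lintegral_count]
  set H : Space d → ℝ := fun ξ => G ((2 * Real.pi)⁻¹ • ξ) with hH
  have hbd : ∀ i ξ, ‖rescale (f i) ξ‖ ≤ r * H ξ := fun i ξ =>
    (norm_rescale_le _ ξ).trans (hf i _)
  have hmr : ∀ i, AEStronglyMeasurable (rescale (f i)) volume := fun i =>
    aestronglyMeasurable_rescale (hm i).1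
  have key : Tendsto (fun i => ∫⁻ n : Fin d → ℤ, eLpNorm (rescale (f i)) 2
      (volume.restrict (unitCube n)) ∂Measure.count) l
      (𝓝 (∫⁻ _ : Fin d → ℤ, 0 ∂Measure.count)) := by
    refine tendsto_lintegral_filter_of_dominated_convergence
      (fun n : Fin d → ℤ => ENNReal.ofReal r * eLpNorm H 2 (volume.restrict (unitCube n)))
      (Eventually.of_forall fun i => measurable_of_countable _)
      (Eventually.of_forall fun i => Eventually.of_forall fun n => ?_) ?_
      (Eventually.of_forall fun n => ?_)
    · refine eLpNorm_le_mul_eLpNorm_of_ae_le_mul (Eventually.of_forall fun ξ => ?_) 2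
      rw [Real.norm_of_nonneg (hG.pos _).le]
      exact hbd i ξ
    · rw [lintegral_count, ENNReal.tsum_mul_left]
      exact (ENNReal.mul_lt_top ENNReal.ofReal_lt_top hG.tsum_eLpNorm_lt_top).ne
    · refine tendsto_eLpNorm_two_zero ((hG.memLp_rescaled.const_mul r).restrict _)
        (fun i => (hmr i).restrict) hbd fun ξ => ?_
      have := (hlim ((2 * Real.pi)⁻¹ • ξ)).const_mul (((2 * Real.pi) ^ d : ℝ)⁻¹ : ℂ)
      rw [mul_zero] at this
      exact this
  simpa using key

theorem continuous_toLp (hG : IsEnvelope G K) {f : ℝ → Space d → ℂ} {r : ℝ}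
    (hfc : Continuous (Function.uncurry f)) (hf : ∀ t x, ‖f t x‖ ≤ r * G x)
    (hm : ∀ t, MemLp (f t) 2) : Continuous fun t => ((hm t).toLp (f t) : L2 d) := by
  have hc : ∀ t, Continuous (f t) := fun t => hfc.comp (f := fun x => (t, x)) (by fun_prop)
  refine continuous_iff_continuousAt.2 fun t => ?_
  rw [ContinuousAt, tendsto_iff_edist_tendsto_0]
  simp only [Lp.edist_toLp_toLp]
  refine tendsto_eLpNorm_two_zero (hG.memLp_two.const_mul (r + r))
    (fun i => ((hm i).sub (hm t)).1) (fun i x => ?_) fun x => ?_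
  · refine (norm_sub_le _ _).trans ?_
    linarith [hf i x, hf t x]
  · have : Continuous fun τ => f τ x := hfc.comp (f := fun τ => (τ, x)) (by fun_prop)
    exact tendsto_sub_nhds_zero_iff.2 (this.tendsto t)

/-- The Bochner integral in `L²` of a dominated continuous family of functions is the pointwise
integral. -/
theorem intervalIntegral_toLp (hG : IsEnvelope G K) {f : ℝ → Space d → ℂ} {r : ℝ}
    (hfc : Continuous (Function.uncurry f)) (hf : ∀ t x, ‖f t x‖ ≤ r * G x)
    (hm : ∀ t, MemLp (f t) 2) {t : ℝ} (ht : 0 ≤ t)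
    (hi : MemLp (fun x => ∫ τ in (0 : ℝ)..t, f τ x) 2) :
    ∫ τ in (0 : ℝ)..t, ((hm τ).toLp (f τ) : L2 d) = hi.toLp _ := by
  -- test against `k ∈ L²` and use Fubini's theorem
  refine ext_inner_left ℂ fun k => ?_
  have hint : IntervalIntegrable (fun τ => ((hm τ).toLp (f τ) : L2 d)) volume 0 t :=
    (hG.continuous_toLp hfc hf hm).intervalIntegrable _ _
  have h1 := (innerSL ℂ k).intervalIntegral_comp_comm hint
  simp only [innerSL_apply_apply] at h1
  rw [← h1]
  have h2 : ∀ g : Space d → ℂ, ∀ hg : MemLp g 2, inner ℂ k (hg.toLp g : L2 d) =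
      ∫ x, g x * (starRingEnd ℂ) (k x) := fun g hg => by
    rw [L2.inner_def]
    refine integral_congr_ae ?_
    filter_upwards [hg.coeFn_toLp] with x hx
    rw [hx]; rfl
  simp only [h2, intervalIntegral.integral_of_le ht]
  rw [integral_integral_swap]
  · simp only [← integral_mul_const]
  · have hk : Integrable (fun x => r * (G x * ‖k x‖)) :=
      ((hG.memLp_two.integrable_mul (Lp.memLp k).norm)).const_mul r
    refine (hk.comp_snd (volume.restrict (Set.Ioc 0 t))).mono' ?_
      (Eventually.of_forall fun z => ?_)
    · refine AEStronglyMeasurable.mul hfc.aestronglyMeasurable ?_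
      exact (Complex.continuous_conj.comp_aestronglyMeasurable
        (Lp.aestronglyMeasurable k)).comp_snd
    · change ‖f z.1 z.2 * (starRingEnd ℂ) (k z.2)‖ ≤ _
      rw [norm_mul, RCLike.norm_conj, ← mul_assoc]
      exact mul_le_mul_of_nonneg_right (hf _ _) (norm_nonneg _)

theorem ofFourier_ae_eq (hG : IsEnvelope G K) {f : Space d → ℂ} {r : ℝ} (hfc : Continuous f)
    (hf : ∀ x, ‖f x‖ ≤ r * G x) (hm : MemLp f 2) : ofFourier f hm =ᵐ[volume] 𝓕⁻ f :=
  fourierInv_toLp_ae_eq (hG.integrable_of_norm_le hfc hf) hm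

/-- On the Fourier side the nonlinearity is the convolution power. -/
theorem powerFun_ofFourier_ae_eq (hG : IsEnvelope G K) {f : Space d → ℂ} {r : ℝ}
    (hfc : Continuous f) (hf : ∀ x, ‖f x‖ ≤ r * G x) (hm : MemLp f 2) (σ : ℕ)
    (hm' : MemLp (convPow σ f) 2) :
    powerFun σ (ofFourier f hm) =ᵐ[volume] ofFourier (convPow σ f) hm' := by
  filter_upwards [hG.ofFourier_ae_eq hfc hf hm, hG.ofFourier_ae_eq
    (hG.continuous_convPow_apply hfc hf σ) (hG.norm_convPow_le hf σ) hm'] with x h1 h2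
  rw [powerFun, h1, h2, hG.fourierInv_convPow hfc hf]

theorem memLp_powerFun_ofFourier (hG : IsEnvelope G K) {f : Space d → ℂ} {r : ℝ}
    (hfc : Continuous f) (hf : ∀ x, ‖f x‖ ≤ r * G x) (hm : MemLp f 2) (σ : ℕ) :
    MemLp (powerFun σ (ofFourier f hm)) 2 :=
  (memLp_congr_ae (hG.powerFun_ofFourier_ae_eq hfc hf hm σ (hG.memLp_two_of_norm_le
    (hG.continuous_convPow_apply hfc hf σ) (hG.norm_convPow_le hf σ)))).2 (Lp.memLp _)

theorem power_ofFourier (hG : IsEnvelope G K) {f : Space d → ℂ} {r : ℝ}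
    (hfc : Continuous f) (hf : ∀ x, ‖f x‖ ≤ r * G x) (hm : MemLp f 2) (σ : ℕ)
    (hm' : MemLp (convPow σ f) 2) :
    power σ (ofFourier f hm) = ofFourier (convPow σ f) hm' := by
  rw [power, dif_pos (hG.memLp_powerFun_ofFourier hfc hf hm σ)]
  refine Lp.ext ((MemLp.coeFn_toLp _).trans (hG.powerFun_ofFourier_ae_eq hfc hf hm σ hm'))

/-- A dominated solution of the integral equation on the Fourier side gives a solution. -/
theorem isSolution_ofFourier (hG : IsEnvelope G K) (σ : ℕ) {μ : ℝ}
    {u₀ : Space d → ℂ} (hm₀ : MemLp u₀ 2)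
    {u : ℝ → Space d → ℂ} {r T : ℝ} (huc : Continuous (Function.uncurry u))
    (hu : ∀ t x, ‖u t x‖ ≤ r * G x) (hm : ∀ t, MemLp (u t) 2)
    (heq : ∀ t ∈ Set.Icc 0 T, ∀ x, u t x = duhamelMap σ μ u₀ u t x) :
    IsSolution σ μ T (ofFourier u₀ hm₀) fun t => ofFourier (u t) (hm t) := by
  have hc : ∀ t, Continuous (u t) := fun t => huc.comp (f := fun x => (t, x)) (by fun_prop)
  have hmp : ∀ t, MemLp (convPow σ (u t)) 2 := fun t => hG.memLp_two_of_norm_le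
    (hG.continuous_convPow_apply (hc t) (hu t) σ) (hG.norm_convPow_le (hu t) σ)
  have hcf : ∀ t, Continuous (Function.uncurry fun τ x =>
      phase (t - τ) x * convPow σ (u τ) x) := fun t =>
    (hG.continuous_integrand σ huc hu).comp
      (f := fun z : ℝ × Space d => ((t, z.2), z.1)) (by fun_prop)
  have hbf : ∀ t τ x, ‖phase (t - τ) x * convPow σ (u τ) x‖ ≤
      ((r * K) ^ (2 * σ) * r) * G x := fun t τ x => by
    rw [norm_mul, norm_phase, one_mul]
    exact hG.norm_convPow_le (hu τ) σ x
  have hmf : ∀ t τ, MemLp (fun x => phase (t - τ) x * convPow σ (u τ) x) 2 := fun t τ =>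
    memLp_phase_mul (hmp τ) _
  have hs : ∀ t τ, schrodinger (t - τ) (power σ (ofFourier (u τ) (hm τ))) =
      ofFourier _ (hmf t τ) := fun t τ => by
    rw [hG.power_ofFourier (hc τ) (hu τ) (hm τ) σ (hmp τ), schrodinger_ofFourier]
  refine ⟨fun t _ => hG.mNorm_ofFourier_lt_top (hu t) (hm t), fun t _ => ?_,
    fun t _ => hG.memLp_powerFun_ofFourier (hc t) (hu t) (hm t) σ, fun t _ => ?_, fun t ht => ?_⟩
  · simp only [← ofFourier_sub]
    refine hG.tendsto_mNorm_ofFourier (r := r + r) (fun τ x => ?_) _ fun x => ?_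
    · refine (norm_sub_le _ _).trans ?_
      linarith [hu τ x, hu t x]
    · have : Continuous fun τ => u τ x := huc.comp (f := fun τ => (τ, x)) (by fun_prop)
      exact (tendsto_sub_nhds_zero_iff.2 (this.tendsto t)).mono_left nhdsWithin_le_nhds
  · simp only [hs]
    exact ((Lp.fourierTransformₗᵢ (Space d) ℂ).symm.continuous.comp
      (hG.continuous_toLp (hcf t) (hbf t) (hmf t))).intervalIntegrable _ _
  · have hmi : MemLp (fun x => ∫ τ in (0 : ℝ)..t, phase (t - τ) x * convPow σ (u τ) x) 2 := by
      refine hG.memLp_two_of_norm_le ?_ (hG.norm_integral_integrand_le σ hu ht.1)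
      exact intervalIntegral.continuous_parametric_intervalIntegral_of_continuous'
        (f := fun x τ => phase (t - τ) x * convPow σ (u τ) x) ((hG.continuous_integrand σ huc hu).comp
          (f := fun z : Space d × ℝ => ((t, z.1), z.2)) (by fun_prop)) _ _
    have hI : ∫ τ in (0 : ℝ)..t, schrodinger (t - τ) (power σ (ofFourier (u τ) (hm τ))) =
        ofFourier _ hmi := by
      simp only [hs]
      rw [ofFourier, ← hG.intervalIntegral_toLp (hcf t) (hbf t) (hmf t) ht.1 hmi]
      exact ((Lp.fourierTransformₗᵢ (Space d) ℂ).symm.toContinuousLinearEquiv :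
        L2 d →L[ℂ] L2 d).intervalIntegral_comp_comm
        ((hG.continuous_toLp (hcf t) (hbf t) (hmf t)).intervalIntegrable _ _)
    rw [hI, schrodinger_ofFourier, ← ofFourier_const_mul, ← ofFourier_sub]
    exact ofFourier_congr _ _ (Eventually.of_forall fun x => heq t ht x)

end IsEnvelope

/-! ### Uniqueness -/

theorem norm_powerFun_sub_le {σ : ℕ} {r : ℝ} {a b : ℂ} (ha : ‖a‖ ≤ r) (hb : ‖b‖ ≤ r) :
    ‖((‖a‖ ^ (2 * σ) : ℝ) : ℂ) * a - ((‖b‖ ^ (2 * σ) : ℝ) : ℂ) * b‖ ≤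
      (2 * σ + 1) * r ^ (2 * σ) * ‖a - b‖ := by
  have hr : 0 ≤ r := (norm_nonneg a).trans ha
  have h1 : |‖a‖ ^ (2 * σ) - ‖b‖ ^ (2 * σ)| * ‖b‖ ≤ 2 * σ * r ^ (2 * σ) * ‖a - b‖ := by
    rcases Nat.eq_zero_or_pos σ with rfl | hσ
    · simp
    calc |‖a‖ ^ (2 * σ) - ‖b‖ ^ (2 * σ)| * ‖b‖
        ≤ (|‖a‖ - ‖b‖| * (2 * σ : ℕ) * max |‖a‖| |‖b‖| ^ (2 * σ - 1)) * r := by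
          gcongr
          exact abs_pow_sub_pow_le _ _ _
      _ ≤ (‖a - b‖ * (2 * σ : ℕ) * r ^ (2 * σ - 1)) * r := by
          have : max |‖a‖| |‖b‖| ≤ r := by simp [ha, hb]
          have := abs_norm_sub_norm_le a b
          gcongr
      _ = 2 * σ * r ^ (2 * σ - 1 + 1) * ‖a - b‖ := by rw [pow_succ]; push_cast; ring
      _ = _ := by rw [Nat.sub_add_cancel (by omega)]
  have h2 : ((‖a‖ ^ (2 * σ) : ℝ) : ℂ) * a - ((‖b‖ ^ (2 * σ) : ℝ) : ℂ) * b =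
      ((‖a‖ ^ (2 * σ) : ℝ) : ℂ) * (a - b) + ((‖a‖ ^ (2 * σ) - ‖b‖ ^ (2 * σ) : ℝ) : ℂ) * b := by
    push_cast; ring
  rw [h2]
  refine (norm_add_le _ _).trans ?_
  rw [norm_mul, norm_mul, Complex.norm_real, Complex.norm_real, Real.norm_eq_abs,
    Real.norm_eq_abs, abs_of_nonneg (by positivity)]
  have h3 : ‖a‖ ^ (2 * σ) * ‖a - b‖ ≤ r ^ (2 * σ) * ‖a - b‖ := by gcongr
  linarith

theorem norm_power_sub_le {d σ : ℕ} {f g : L2 d} {r : ℝ}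
    (hf : MemLp (powerFun σ f) 2) (hg : MemLp (powerFun σ g) 2)
    (hfr : ∀ᵐ x, ‖f x‖ ≤ r) (hgr : ∀ᵐ x, ‖g x‖ ≤ r) :
    ‖power σ f - power σ g‖ ≤ (2 * σ + 1) * r ^ (2 * σ) * ‖f - g‖ := by
  rw [power, power, dif_pos hf, dif_pos hg]
  refine Lp.norm_le_mul_norm_of_ae_le_mul ?_
  filter_upwards [Lp.coeFn_sub (hf.toLp (powerFun σ f)) (hg.toLp (powerFun σ g)),
    Lp.coeFn_sub f g, hf.coeFn_toLp, hg.coeFn_toLp, hfr, hgr] with x h1 h2 h3 h4 h5 h6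
  rw [h1, h2, Pi.sub_apply, Pi.sub_apply, h3, h4]
  exact norm_powerFun_sub_le h5 h6

theorem norm_schrodinger {d : ℕ} (t : ℝ) (f : L2 d) : ‖schrodinger t f‖ = ‖f‖ := by
  have h : ‖schrodinger t f‖ = ‖(memLp_schrodinger t (𝓕 f)).toLp‖ :=
    (Lp.fourierTransformₗᵢ (Space d) ℂ).symm.norm_map _
  rw [h, ← Lp.norm_fourier_eq f, Lp.norm_toLp, Lp.norm_def]
  congr 1
  refine eLpNorm_congr_norm_ae (Eventually.of_forall fun x => ?_)
  rw [norm_mul]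
  exact mul_left_eq_self₀.2 (Or.inl (norm_phase t x))

theorem schrodinger_sub {d : ℕ} (t : ℝ) (f g : L2 d) :
    schrodinger t (f - g) = schrodinger t f - schrodinger t g := by
  have h : ∀ f : L2 d, f = ofFourier (𝓕 f : L2 d) (Lp.memLp _) := fun f => by
    rw [ofFourier, Lp.toLp_coeFn, FourierTransform.fourierInv_fourier_eq]
  rw [h f, h g, ← ofFourier_sub]
  simp only [schrodinger_ofFourier]
  rw [← ofFourier_sub]
  exact ofFourier_congr _ _ (Eventually.of_forall fun x => mul_sub _ _ _)

namespace IsSolution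

variable {d σ : ℕ} {μ T : ℝ} {ψ₀ : L2 d} {ψ φ : ℝ → L2 d}

/-- A solution is bounded, by compactness of `[0, T]` and continuity in `M`. -/
theorem exists_norm_le (h : IsSolution σ μ T ψ₀ ψ) :
    ∃ r : ℝ, ∀ t ∈ Set.Icc 0 T, ∀ᵐ x, ‖ψ t x‖ ≤ r := by
  have key : ∃ r : ℝ≥0∞, r < ∞ ∧ ∀ t ∈ Set.Icc 0 T, mNorm (ψ t) ≤ r := by
    refine isCompact_Icc.induction_on (p := fun S => ∃ r : ℝ≥0∞, r < ∞ ∧ ∀ t ∈ S, mNorm (ψ t) ≤ r)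
      ⟨0, by simp, by simp⟩ ?_ ?_ fun t ht => ?_
    · rintro S S' hS ⟨r, hr, h⟩
      exact ⟨r, hr, fun t ht => h t (hS ht)⟩
    · rintro S S' ⟨r, hr, h⟩ ⟨r', hr', h'⟩
      refine ⟨max r r', max_lt hr hr', fun t ht => ?_⟩
      rcases ht with ht | ht
      · exact (h t ht).trans (le_max_left _ _)
      · exact (h' t ht).trans (le_max_right _ _)
    · refine ⟨{τ | mNorm (ψ τ - ψ t) < 1},
        (h.continuous t ht).eventually_lt_const (by norm_num), mNorm (ψ t) + 1,
        ENNReal.add_lt_top.2 ⟨h.mem t ht, by simp⟩, fun τ hτ => ?_⟩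
      exact (mNorm_le_add _ _).trans (add_le_add le_rfl (le_of_lt hτ))
  obtain ⟨r, hr, hb⟩ := key
  refine ⟨r.toReal, fun t ht => ?_⟩
  filter_upwards [norm_le_mNorm (ψ t) (h.mem t ht)] with x hx
  exact hx.trans (ENNReal.toReal_mono hr.ne (hb t ht))

/-- Duhamel's formula for the difference of two solutions. -/
theorem norm_sub_le_integral (hμ : |μ| ≤ 1) (h : IsSolution σ μ T ψ₀ ψ)
    (h' : IsSolution σ μ T ψ₀ φ) {t : ℝ} (ht : t ∈ Set.Icc 0 T) {b : ℝ → ℝ}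
    (hb : IntervalIntegrable b volume 0 t)
    (hle : ∀ τ ∈ Set.Icc 0 T, ‖power σ (ψ τ) - power σ (φ τ)‖ ≤ b τ) :
    ‖ψ t - φ t‖ ≤ ∫ τ in (0 : ℝ)..t, b τ := by
  have e : ψ t - φ t = -((Complex.I * (μ : ℂ)) • ∫ τ in (0 : ℝ)..t,
      (schrodinger (t - τ) (power σ (ψ τ)) - schrodinger (t - τ) (power σ (φ τ)))) := by
    rw [intervalIntegral.integral_sub (h.integrable t ht) (h'.integrable t ht), smul_sub,
      h.duhamel t ht, h'.duhamel t ht]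
    abel
  rw [e, norm_neg, norm_smul, norm_mul, Complex.norm_I, one_mul, Complex.norm_real,
    Real.norm_eq_abs]
  refine (mul_le_of_le_one_left (norm_nonneg _) hμ).trans ?_
  refine intervalIntegral.norm_integral_le_of_norm_le ht.1
    (Eventually.of_forall fun τ hτ => ?_) hb
  rw [← schrodinger_sub, norm_schrodinger]
  exact hle τ ⟨hτ.1.le, hτ.2.trans ht.2⟩

/-- Uniqueness, by iterating the Duhamel estimate in `L²`: a solution is bounded, so the
nonlinearity is Lipschitz in `L²` along two solutions. -/
theorem unique (hμ : |μ| ≤ 1) (hT : 0 ≤ T) (h : IsSolution σ μ T ψ₀ ψ)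
    (h' : IsSolution σ μ T ψ₀ φ) : ∀ t ∈ Set.Icc 0 T, ψ t = φ t := by
  obtain ⟨r₁, hr₁⟩ := h.exists_norm_le
  obtain ⟨r₂, hr₂⟩ := h'.exists_norm_le
  set r := max 0 (max r₁ r₂)
  set C : ℝ := (2 * σ + 1) * r ^ (2 * σ)
  have hC : 0 ≤ C := by positivity
  have hLip : ∀ τ ∈ Set.Icc 0 T, ‖power σ (ψ τ) - power σ (φ τ)‖ ≤ C * ‖ψ τ - φ τ‖ :=
    fun τ hτ => norm_power_sub_le (h.power_mem τ hτ) (h'.power_mem τ hτ)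
      ((hr₁ τ hτ).mono fun x hx => hx.trans (by simp [r]))
      ((hr₂ τ hτ).mono fun x hx => hx.trans (by simp [r]))
  have hTT : T ∈ Set.Icc 0 T := ⟨hT, le_rfl⟩
  have hi : IntervalIntegrable (fun τ => ‖power σ (ψ τ)‖ + ‖power σ (φ τ)‖) volume 0 T := by
    have h1 := (h.integrable T hTT).norm
    have h2 := (h'.integrable T hTT).norm
    simp only [norm_schrodinger] at h1 h2
    exact h1.add h2
  -- `M` is an a priori bound for the difference, with which the iteration starts
  set M := ∫ τ in (0 : ℝ)..T, (‖power σ (ψ τ)‖ + ‖power σ (φ τ)‖)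
  have key : ∀ n : ℕ, ∀ t ∈ Set.Icc 0 T, ‖ψ t - φ t‖ ≤ M * (C ^ n / n.factorial * t ^ n) := by
    intro n
    induction n with
    | zero =>
      intro t ht
      have hsub : Set.uIcc 0 t ⊆ Set.uIcc 0 T := by
        rw [Set.uIcc_of_le ht.1, Set.uIcc_of_le hT]
        exact Set.Icc_subset_Icc_right ht.2
      refine (norm_sub_le_integral hμ h h' ht (hi.mono_set hsub)
        fun τ _ => norm_sub_le _ _).trans ?_
      simp only [pow_zero, Nat.factorial_zero, Nat.cast_one, div_one, mul_one]
      exact intervalIntegral.integral_mono_interval le_rfl ht.1 ht.2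
        (Eventually.of_forall fun τ => by positivity) hi
    | succ n ih =>
      intro t ht
      refine (norm_sub_le_integral hμ h h' ht (b := fun τ => C * (M * (C ^ n / n.factorial * τ ^ n)))
        (Continuous.intervalIntegrable (by fun_prop) _ _)
        fun τ hτ => (hLip τ hτ).trans (by gcongr; exact ih τ hτ)).trans (le_of_eq ?_)
      simp only [intervalIntegral.integral_const_mul, integral_pow, Nat.factorial_succ]
      push_cast
      field_simp
      ring
  intro t ht
  have hlim : Tendsto (fun n : ℕ => M * (C ^ n / n.factorial * t ^ n)) atTop (𝓝 (M * 0)) := by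
    refine Tendsto.const_mul _ ?_
    refine (FloorSemiring.tendsto_pow_div_factorial_atTop (C * t)).congr fun n => ?_
    rw [mul_pow]; ring
  have h0 : ‖ψ t - φ t‖ ≤ M * 0 := ge_of_tendsto' hlim fun n => key n t ht
  rw [mul_zero] at h0
  exact sub_eq_zero.1 (norm_le_zero_iff.1 h0)

end IsSolution

/-! ### An envelope adapted to an arithmetic progression of frequencies -/

/-- The inequality `w(x) w(y) ≤ C w(x+y) (w(x) + w(y))` for a weight `w = p⁻ⁿ` such that
`p(x+y) ≤ 2 p(x) + 2 p(y)`; integrated, it says that `w * w ≲ w`. -/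
theorem inv_pow_mul_inv_pow_le {p q s : ℝ} (hp : 0 < p) (hq : 0 < q) (hs : 0 < s)
    (h : s ≤ 2 * p + 2 * q) (n : ℕ) :
    (p ^ n)⁻¹ * (q ^ n)⁻¹ ≤ 4 ^ n * (s ^ n)⁻¹ * ((p ^ n)⁻¹ + (q ^ n)⁻¹) := by
  wlog hpq : p ≤ q generalizing p q with H
  · have := H hq hp (by linarith) (by linarith)
    rwa [mul_comm (q ^ n)⁻¹, add_comm (q ^ n)⁻¹] at this
  have h1 : (q ^ n)⁻¹ ≤ 4 ^ n * (s ^ n)⁻¹ := by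
    rw [← div_eq_mul_inv, inv_le_comm₀ (by positivity) (by positivity), inv_div,
      div_le_iff₀ (by positivity), ← mul_pow]
    gcongr
    linarith
  calc (p ^ n)⁻¹ * (q ^ n)⁻¹ = (q ^ n)⁻¹ * (p ^ n)⁻¹ := mul_comm _ _
    _ ≤ 4 ^ n * (s ^ n)⁻¹ * ((p ^ n)⁻¹ + (q ^ n)⁻¹) := by
      gcongr
      exact le_add_of_nonneg_right (by positivity)

/-- The weight `(1 + j²)⁻¹` on `ℤ`. -/
def latticeWeight (j : ℤ) : ℝ := (1 + (j : ℝ) ^ 2)⁻¹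

theorem latticeWeight_pos (j : ℤ) : 0 < latticeWeight j := by unfold latticeWeight; positivity

theorem latticeWeight_mul_le (i j : ℤ) : latticeWeight i * latticeWeight j ≤
    4 * latticeWeight (i + j) * (latticeWeight i + latticeWeight j) := by
  have := inv_pow_mul_inv_pow_le (p := 1 + (i : ℝ) ^ 2) (q := 1 + (j : ℝ) ^ 2)
    (s := 1 + ((i + j : ℤ) : ℝ) ^ 2) (by positivity) (by positivity) (by positivity)
    (by push_cast; nlinarith [sq_nonneg ((i : ℝ) - j)]) 1
  simpa [latticeWeight] using this

theorem summable_latticeWeight : Summable latticeWeight := by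
  have h : Summable fun j : ℤ => 1 / (j : ℝ) ^ 2 := Real.summable_one_div_int_pow.2 (by norm_num)
  have h' : Summable fun j : ℤ => 1 / (j : ℝ) ^ 2 + if j = 0 then 1 else 0 :=
    h.add (summable_of_hasFiniteSupport ((Set.finite_singleton (0 : ℤ)).subset fun j hj => by
      by_contra hne
      simp_all))
  refine h'.of_nonneg_of_le (fun j => (latticeWeight_pos j).le) fun j => ?_
  rcases eq_or_ne j 0 with rfl | hj
  · simp [latticeWeight]
  · have : (0 : ℝ) < (j : ℝ) ^ 2 := by positivity
    simp only [latticeWeight, hj, if_false, add_zero, one_div]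
    gcongr
    linarith

/-- The profile `(1 + |x|²)^{-d}`. -/
def profile {d : ℕ} (x : Space d) : ℝ := ((1 + ‖x‖ ^ 2) ^ d)⁻¹

section Profile

variable {d : ℕ}

theorem profile_pos (x : Space d) : 0 < profile x := by unfold profile; positivity

theorem profile_le_one (x : Space d) : profile x ≤ 1 :=
  inv_le_one_of_one_le₀ (one_le_pow₀ (by nlinarith [sq_nonneg ‖x‖]))

theorem profile_neg (x : Space d) : profile (-x) = profile x := by simp [profile]

@[fun_prop]
theorem continuous_profile : Continuous (profile : Space d → ℝ) := by
  unfold profile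
  exact Continuous.inv₀ (by fun_prop) fun x => by positivity

theorem integrable_profile (hd : 1 ≤ d) : Integrable (profile : Space d → ℝ) := by
  have h := integrable_rpow_neg_one_add_norm_sq (E := Space d) (μ := volume) (r := 2 * d) (by
    rw [finrank_euclideanSpace_fin]
    have : (1 : ℝ) ≤ d := by exact_mod_cast hd
    linarith)
  refine h.congr (Eventually.of_forall fun x => ?_)
  simp only [profile]
  rw [show -(2 * (d : ℝ)) / 2 = -(d : ℝ) by ring, Real.rpow_neg (by positivity), Real.rpow_natCast]

theorem profile_mul_le (x y : Space d) :
    profile x * profile y ≤ 4 ^ d * profile (x + y) * (profile x + profile y) := by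
  refine inv_pow_mul_inv_pow_le (by positivity) (by positivity) (by positivity) ?_ d
  nlinarith [norm_add_le x y, sq_nonneg (‖x‖ - ‖y‖), norm_nonneg (x + y)]

theorem profile_le_mul {r : ℝ} {x y : Space d} (h : ‖x - y‖ ≤ r) :
    profile x ≤ (2 + 2 * r ^ 2) ^ d * profile y := by
  unfold profile
  rw [← div_eq_mul_inv, inv_le_comm₀ (by positivity) (by positivity), inv_div,
    div_le_iff₀ (by positivity), ← mul_pow]
  gcongr
  have h1 : ‖y‖ ≤ ‖x‖ + ‖x - y‖ := by
    have := norm_sub_le x (x - y)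
    simpa using this
  have h2 : ‖x - y‖ ^ 2 ≤ r ^ 2 := by gcongr
  nlinarith [norm_nonneg y, sq_nonneg (‖x‖ - ‖x - y‖), sq_nonneg ‖x‖, sq_nonneg r,
    mul_nonneg (sq_nonneg ‖x‖) (sq_nonneg r)]

end Profile

/-- The sum of the weights `(1 + j²)⁻¹`, `j ∈ ℤ`. -/
def latticeSum : ℝ := ∑' j, latticeWeight j

theorem latticeSum_pos : 0 < latticeSum :=
  summable_latticeWeight.tsum_pos (fun j => (latticeWeight_pos j).le) 0 (latticeWeight_pos 0)

/-- The envelope of width `A` around the progression `ℤ v`, with the normalized weights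
`(1 + j²)⁻¹`. -/
def envelope {d : ℕ} (A : ℝ) (v : Space d) (x : Space d) : ℝ :=
  latticeSum⁻¹ * ∑' j : ℤ, latticeWeight j * profile (A⁻¹ • (x - j • v))

section Envelope

variable {d : ℕ} {A : ℝ} (v : Space d)

theorem summable_envelope (A : ℝ) (x : Space d) :
    Summable fun j : ℤ => latticeWeight j * profile (A⁻¹ • (x - j • v)) :=
  summable_latticeWeight.of_nonneg_of_le
    (fun j => mul_nonneg (latticeWeight_pos j).le (profile_pos _).le)
    fun j => mul_le_of_le_one_right (latticeWeight_pos j).le (profile_le_one _)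

theorem le_envelope (A : ℝ) (x : Space d) (j : ℤ) :
    latticeSum⁻¹ * (latticeWeight j * profile (A⁻¹ • (x - j • v))) ≤ envelope A v x := by
  unfold envelope
  have := latticeSum_pos
  gcongr
  exact (summable_envelope v A x).le_tsum j fun i _ =>
    mul_nonneg (latticeWeight_pos i).le (profile_pos _).le

theorem envelope_pos (A : ℝ) (x : Space d) : 0 < envelope A v x :=
  (mul_pos (inv_pos.2 latticeSum_pos) (mul_pos (latticeWeight_pos 0) (profile_pos _))).trans_le
    (le_envelope v A x 0)

theorem envelope_le_one (A : ℝ) (x : Space d) : envelope A v x ≤ 1 := by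
  unfold envelope
  rw [inv_mul_le_iff₀ latticeSum_pos, mul_one]
  exact (summable_envelope v A x).tsum_le_tsum
    (fun j => mul_le_of_le_one_right (latticeWeight_pos j).le (profile_le_one _))
    summable_latticeWeight

theorem envelope_neg (A : ℝ) (x : Space d) : envelope A v (-x) = envelope A v x := by
  unfold envelope
  rw [← (Equiv.neg ℤ).tsum_eq]
  congr 1
  refine tsum_congr fun j => ?_
  have h1 : A⁻¹ • (-x - (-j) • v) = -(A⁻¹ • (x - j • v)) := by
    rw [show -x - (-j) • v = -(x - j • v) by rw [neg_smul]; abel, smul_neg]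
  simp only [Equiv.neg_apply, h1, profile_neg]
  simp [latticeWeight]

theorem continuous_envelope (A : ℝ) : Continuous (envelope A v) := by
  unfold envelope
  refine continuous_const.mul (continuous_tsum (u := latticeWeight) (fun j => by fun_prop)
    summable_latticeWeight fun j x => ?_)
  rw [norm_mul, Real.norm_of_nonneg (latticeWeight_pos j).le,
    Real.norm_of_nonneg (profile_pos _).le]
  exact mul_le_of_le_one_right (latticeWeight_pos j).le (profile_le_one _)

theorem envelope_le_mul (r : ℝ) (x y : Space d) (h : ‖x - y‖ ≤ r) :
    envelope A v x ≤ (2 + 2 * (|A⁻¹| * r) ^ 2) ^ d * envelope A v y := by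
  unfold envelope
  rw [mul_left_comm]
  have := latticeSum_pos
  gcongr
  rw [← tsum_mul_left]
  refine (summable_envelope v A x).tsum_le_tsum (fun j => ?_)
    ((summable_envelope v A y).mul_left _)
  rw [mul_left_comm]
  refine mul_le_mul_of_nonneg_left (profile_le_mul ?_) (latticeWeight_pos j).le
  rw [← smul_sub, sub_sub_sub_cancel_right, norm_smul, Real.norm_eq_abs]
  gcongr

theorem ofReal_envelope (A : ℝ) (x : Space d) : ENNReal.ofReal (envelope A v x) =
    ENNReal.ofReal latticeSum⁻¹ * ∑' j : ℤ, ENNReal.ofReal (latticeWeight j) *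
      ENNReal.ofReal (profile (A⁻¹ • (x - j • v))) := by
  rw [envelope, ENNReal.ofReal_mul (inv_pos.2 latticeSum_pos).le, ENNReal.ofReal_tsum_of_nonneg
    (fun j => mul_nonneg (latticeWeight_pos j).le (profile_pos _).le) (summable_envelope v A x)]
  simp only [ENNReal.ofReal_mul (latticeWeight_pos _).le]

theorem tsum_ofReal_latticeWeight :
    ∑' j, ENNReal.ofReal (latticeWeight j) = ENNReal.ofReal latticeSum :=
  (ENNReal.ofReal_tsum_of_nonneg (fun j => (latticeWeight_pos j).le) summable_latticeWeight).symm

theorem lintegral_profile_smul (hd : 1 ≤ d) (hA : 0 < A) :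
    ∫⁻ x : Space d, ENNReal.ofReal (profile (A⁻¹ • x)) =
      ENNReal.ofReal (A ^ d * ∫ x : Space d, profile x) := by
  rw [← ofReal_integral_eq_lintegral_ofReal
    ((integrable_profile hd).comp_smul (inv_ne_zero hA.ne'))
    (Eventually.of_forall fun x => (profile_pos _).le), Measure.integral_comp_smul,
    finrank_euclideanSpace_fin, inv_pow, inv_inv, abs_of_pos (by positivity), smul_eq_mul]

theorem integrable_envelope (hd : 1 ≤ d) (hA : 0 < A) : Integrable (envelope A v) := by
  refine ⟨(continuous_envelope v A).aestronglyMeasurable, ?_⟩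
  rw [hasFiniteIntegral_iff_ofReal (Eventually.of_forall fun x => (envelope_pos v A x).le)]
  simp only [ofReal_envelope]
  rw [lintegral_const_mul' _ _ ENNReal.ofReal_ne_top, lintegral_tsum fun j => by fun_prop]
  refine ENNReal.mul_lt_top ENNReal.ofReal_lt_top ?_
  have h : ∀ j : ℤ, ∫⁻ x : Space d, ENNReal.ofReal (latticeWeight j) *
      ENNReal.ofReal (profile (A⁻¹ • (x - j • v))) = ENNReal.ofReal (latticeWeight j) *
      ENNReal.ofReal (A ^ d * ∫ x : Space d, profile x) := fun j => by
    rw [lintegral_const_mul' _ _ ENNReal.ofReal_ne_top, ← lintegral_profile_smul hd hA,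
      lintegral_sub_right_eq_self (fun x : Space d => ENNReal.ofReal (profile (A⁻¹ • x)))]
  simp only [h]
  rw [ENNReal.tsum_mul_right, tsum_ofReal_latticeWeight]
  exact ENNReal.mul_lt_top ENNReal.ofReal_lt_top ENNReal.ofReal_lt_top

/-- The weights dominate their self-convolution: the two summands on the right of
`a_i a_j ≤ 4 a_{i+j} (a_i + a_j)` contribute `4` times the sum each. -/
theorem tsum_latticeWeight_mul_le (m : ℤ) :
    ∑' i, ENNReal.ofReal (latticeWeight i) * ENNReal.ofReal (latticeWeight (m - i)) ≤
      ENNReal.ofReal (8 * latticeSum) * ENNReal.ofReal (latticeWeight m) := by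
  calc _ ≤ ∑' i, ENNReal.ofReal (4 * latticeWeight m) *
        (ENNReal.ofReal (latticeWeight i) + ENNReal.ofReal (latticeWeight (m - i))) := by
        refine ENNReal.tsum_le_tsum fun i => ?_
        rw [← ENNReal.ofReal_mul (latticeWeight_pos _).le,
          ← ENNReal.ofReal_add (latticeWeight_pos _).le (latticeWeight_pos _).le,
          ← ENNReal.ofReal_mul (by have := latticeWeight_pos m; positivity)]
        refine ENNReal.ofReal_le_ofReal ?_
        have := latticeWeight_mul_le i (m - i)
        rwa [add_sub_cancel] at this
    _ = ENNReal.ofReal (4 * latticeWeight m) *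
        (ENNReal.ofReal latticeSum + ENNReal.ofReal latticeSum) := by
        have := (Equiv.subLeft m).tsum_eq fun i => ENNReal.ofReal (latticeWeight i)
        simp only [Equiv.subLeft_apply] at this
        rw [ENNReal.tsum_mul_left, ENNReal.tsum_add, this, tsum_ofReal_latticeWeight]
    _ = _ := by
        have h1 := latticeSum_pos
        have h2 := latticeWeight_pos m
        rw [← ENNReal.ofReal_add h1.le h1.le, ← ENNReal.ofReal_mul (by positivity),
          ← ENNReal.ofReal_mul (by positivity)]
        congr 1
        ring

/-- The convolution of two translates of the profile is dominated by the profile at the sum of the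
centres, with a constant of the order of the volume `A^d`. -/
theorem lintegral_profile_mul_le (hd : 1 ≤ d) (hA : 0 < A) (a b : Space d) :
    ∫⁻ y : Space d, ENNReal.ofReal (profile (A⁻¹ • (y - a))) *
      ENNReal.ofReal (profile (A⁻¹ • (b - y))) ≤
    ENNReal.ofReal (2 * 4 ^ d * (A ^ d * ∫ x : Space d, profile x)) *
      ENNReal.ofReal (profile (A⁻¹ • (b - a))) := by
  have hI : 0 ≤ ∫ x : Space d, profile x := integral_nonneg fun x => (profile_pos x).le
  calc _ ≤ ∫⁻ y : Space d, ENNReal.ofReal (4 ^ d * profile (A⁻¹ • (b - a))) *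
        (ENNReal.ofReal (profile (A⁻¹ • (y - a))) +
          ENNReal.ofReal (profile (A⁻¹ • (b - y)))) := by
        refine lintegral_mono fun y => ?_
        rw [← ENNReal.ofReal_mul (profile_pos _).le,
          ← ENNReal.ofReal_add (profile_pos _).le (profile_pos _).le,
          ← ENNReal.ofReal_mul (by have := profile_pos (A⁻¹ • (b - a)); positivity)]
        refine ENNReal.ofReal_le_ofReal ?_
        have := profile_mul_le (A⁻¹ • (y - a)) (A⁻¹ • (b - y))
        rwa [← smul_add, show y - a + (b - y) = b - a by abel] at this
    _ = ENNReal.ofReal (4 ^ d * profile (A⁻¹ • (b - a))) *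
        (ENNReal.ofReal (A ^ d * ∫ x : Space d, profile x) +
          ENNReal.ofReal (A ^ d * ∫ x : Space d, profile x)) := by
        rw [lintegral_const_mul' _ _ ENNReal.ofReal_ne_top, lintegral_add_left (by fun_prop),
          lintegral_sub_right_eq_self (fun x : Space d => ENNReal.ofReal (profile (A⁻¹ • x))),
          lintegral_sub_left_eq_self (fun x : Space d => ENNReal.ofReal (profile (A⁻¹ • x))),
          lintegral_profile_smul hd hA]
    _ = _ := by
        have := profile_pos (A⁻¹ • (b - a))
        generalize (∫ x : Space d, profile x) = I at hI ⊢
        generalize profile (A⁻¹ • (b - a)) = P at this ⊢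
        rw [← ENNReal.ofReal_add (by positivity) (by positivity),
          ← ENNReal.ofReal_mul (by positivity), ← ENNReal.ofReal_mul (by positivity)]
        congr 1
        ring

theorem integral_envelope_mul_le (hd : 1 ≤ d) (hA : 0 < A) (x : Space d) :
    ∫ y, envelope A v y * envelope A v (x - y) ≤
      (16 * 4 ^ d * (∫ x : Space d, profile x)) * A ^ d * envelope A v x := by
  have hI : 0 ≤ ∫ x : Space d, profile x := integral_nonneg fun x => (profile_pos x).le
  have hS := latticeSum_pos
  have hx := envelope_pos v A x
  have hc := continuous_envelope v A
  set b : ℤ → ℝ≥0∞ := fun j => ENNReal.ofReal (latticeWeight j)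
  set k : Space d → ℝ≥0∞ := fun x => ENNReal.ofReal (profile (A⁻¹ • x)) with hk
  have hkm : Measurable k := by fun_prop
  set c := ENNReal.ofReal (2 * 4 ^ d * (A ^ d * ∫ x : Space d, profile x))
  have hle : ∀ i j : ℤ, ∫⁻ y, k (y - i • v) * k (x - y - j • v) ≤ c * k (x - (i + j) • v) :=
    fun i j => by
      have := lintegral_profile_mul_le hd hA (i • v) (x - j • v)
      rw [show x - j • v - i • v = x - (i + j) • v by rw [add_smul]; abel] at this
      simpa only [sub_right_comm x _ (j • v)] using this
  have key : ∫⁻ y, (∑' i, b i * k (y - i • v)) * (∑' j, b j * k (x - y - j • v)) ≤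
      c * ENNReal.ofReal (8 * latticeSum) * ∑' m, b m * k (x - m • v) := by
    calc _ = ∑' i, ∑' j, b i * b j * ∫⁻ y, k (y - i • v) * k (x - y - j • v) := by
          simp only [← ENNReal.tsum_mul_right, ← ENNReal.tsum_mul_left]
          conv_rhs => rw [ENNReal.tsum_comm]
          rw [lintegral_tsum fun i => by fun_prop]
          refine tsum_congr fun i => ?_
          rw [lintegral_tsum fun i => by fun_prop]
          refine tsum_congr fun j => ?_
          rw [← lintegral_const_mul' _ _ (ENNReal.mul_ne_top ENNReal.ofReal_ne_top
            ENNReal.ofReal_ne_top)]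
          exact lintegral_congr fun y => by ring
      _ ≤ ∑' i, ∑' j, b i * b j * (c * k (x - (i + j) • v)) := by
          gcongr with i j
          exact hle i j
      _ = ∑' i, ∑' m, b i * b (m - i) * (c * k (x - m • v)) := by
          refine tsum_congr fun i => ?_
          rw [← (Equiv.subRight i).tsum_eq]
          refine tsum_congr fun m => ?_
          simp
      _ = ∑' m, (∑' i, b i * b (m - i)) * (c * k (x - m • v)) := by
          rw [ENNReal.tsum_comm]
          simp only [ENNReal.tsum_mul_right]
      _ ≤ ∑' m, ENNReal.ofReal (8 * latticeSum) * b m * (c * k (x - m • v)) := by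
          gcongr with m
          exact tsum_latticeWeight_mul_le m
      _ = _ := by
          rw [← ENNReal.tsum_mul_left]
          refine tsum_congr fun m => ?_
          ring
  rw [integral_eq_lintegral_of_nonneg_ae
    (Eventually.of_forall fun y => mul_nonneg (envelope_pos v A _).le (envelope_pos v A _).le)
    (by fun_prop)]
  refine ENNReal.toReal_le_of_le_ofReal (by positivity) ?_
  calc ∫⁻ y, ENNReal.ofReal (envelope A v y * envelope A v (x - y))
      = ENNReal.ofReal latticeSum⁻¹ * ENNReal.ofReal latticeSum⁻¹ *
        ∫⁻ y, (∑' i, b i * k (y - i • v)) * (∑' j, b j * k (x - y - j • v)) := by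
        rw [← lintegral_const_mul' _ _ (ENNReal.mul_ne_top ENNReal.ofReal_ne_top
          ENNReal.ofReal_ne_top)]
        refine lintegral_congr fun y => ?_
        rw [ENNReal.ofReal_mul (envelope_pos v A _).le, ofReal_envelope, ofReal_envelope]
        ring
    _ ≤ ENNReal.ofReal latticeSum⁻¹ * ENNReal.ofReal latticeSum⁻¹ *
        (c * ENNReal.ofReal (8 * latticeSum) * ∑' m, b m * k (x - m • v)) := by gcongr
    _ = ENNReal.ofReal latticeSum⁻¹ * (c * ENNReal.ofReal (8 * latticeSum)) *
        ENNReal.ofReal (envelope A v x) := by rw [ofReal_envelope]; ring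
    _ = _ := by
        rw [← ENNReal.ofReal_mul (by positivity), ← ENNReal.ofReal_mul (by positivity),
          ← ENNReal.ofReal_mul (by positivity)]
        congr 1
        field_simp
        ring

theorem isEnvelope_envelope (hd : 1 ≤ d) (hA : 0 < A) :
    IsEnvelope (envelope A v) ((16 * 4 ^ d * (∫ x : Space d, profile x)) * A ^ d) where
  continuous := continuous_envelope v A
  pos := envelope_pos v A
  le_one := envelope_le_one v A
  even := envelope_neg v A
  integrable := integrable_envelope v hd hA
  integral_le := integral_envelope_mul_le v hd hA
  slow r := ⟨_, by positivity, envelope_le_mul v r⟩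

theorem le_envelope_of_norm_sub_le (hA : 0 < A) {j : ℤ} {x : Space d} (h : ‖x - j • v‖ ≤ A) :
    latticeSum⁻¹ * latticeWeight j * (2 ^ d)⁻¹ ≤ envelope A v x := by
  refine le_trans ?_ (le_envelope v A x j)
  rw [mul_assoc]
  have := latticeSum_pos
  have := latticeWeight_pos j
  gcongr
  unfold profile
  gcongr
  have : ‖A⁻¹ • (x - j • v)‖ ≤ 1 := by
    rw [norm_smul, norm_inv, Real.norm_of_nonneg hA.le, inv_mul_le_iff₀ hA, mul_one]
    exact h
  nlinarith [norm_nonneg (A⁻¹ • (x - j • v))]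

end Envelope

theorem integral_profile_pos {d : ℕ} (hd : 1 ≤ d) : 0 < ∫ x : Space d, profile x := by
  rw [integral_pos_iff_support_of_nonneg (fun x => (profile_pos x).le) (integrable_profile hd)]
  have : Function.support (profile : Space d → ℝ) = Set.univ :=
    Set.eq_univ_of_forall fun x => (profile_pos x).ne'
  rw [this]
  exact Measure.measure_univ_pos.2 (NeZero.ne _)

/-! ### The resonant interaction at low frequencies -/

/-- The convolution of real-valued functions. -/
def realConv {d : ℕ} (F H : Space d → ℝ) (x : Space d) : ℝ := ∫ y, F y * H (x - y)

theorem conv_ofReal {d : ℕ} (F H : Space d → ℝ) :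
    conv (fun x => (F x : ℂ)) (fun x => (H x : ℂ)) = fun x => (realConv F H x : ℂ) := by
  ext x
  rw [conv, realConv, ← integral_complex_ofReal]
  simp only [Complex.ofReal_mul]

/-- The convolution power of `convPow` for real-valued functions. -/
def realConvPow {d : ℕ} : ℕ → (Space d → ℝ) → Space d → ℝ
  | 0, F => F
  | k + 1, F => realConv (realConv F fun x => F (-x)) (realConvPow k F)

theorem convPow_ofReal {d : ℕ} (F : Space d → ℝ) (k : ℕ) :
    convPow k (fun x => (F x : ℂ)) = fun x => (realConvPow k F x : ℂ) := by
  induction k with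
  | zero => rfl
  | succ k ih =>
    have : invol (fun x => (F x : ℂ)) = fun x => (F (-x) : ℂ) := by
      ext x; simp [invol]
    rw [convPow, ih, this, conv_ofReal, conv_ofReal]
    rfl

theorem realConv_nonneg {d : ℕ} {F H : Space d → ℝ} (hF : ∀ x, 0 ≤ F x) (hH : ∀ x, 0 ≤ H x)
    (x : Space d) : 0 ≤ realConv F H x :=
  integral_nonneg fun _ => mul_nonneg (hF _) (hH _)

theorem realConvPow_nonneg {d : ℕ} {F : Space d → ℝ} (hF : ∀ x, 0 ≤ F x) (k : ℕ) (x : Space d) :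
    0 ≤ realConvPow k F x := by
  induction k generalizing x with
  | zero => exact hF x
  | succ k ih => exact realConv_nonneg (realConv_nonneg hF fun x => hF _) ih x

/-- Lower bound for a convolution of nonnegative functions that are bounded below on balls. -/
theorem le_realConv {d : ℕ} {F H : Space d → ℝ} (hF : ∀ x, 0 ≤ F x) (hH : ∀ x, 0 ≤ H x)
    {a b z : Space d} {r s m n : ℝ} (hn : 0 ≤ n)
    (hFm : ∀ x, ‖x - a‖ ≤ r + s → m ≤ F x) (hHn : ∀ x, ‖x - b‖ ≤ s → n ≤ H x)
    (hi : Integrable fun y => F y * H (z - y)) (hz : ‖z - (a + b)‖ ≤ r) :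
    m * n * volume.real (Metric.closedBall (0 : Space d) s) ≤ realConv F H z := by
  have hv : volume.real (Metric.closedBall (0 : Space d) s) =
      volume.real (Metric.closedBall (z - b) s) := by
    rw [measureReal_def, measureReal_def, Measure.addHaar_closedBall_center volume (z - b) s]
  calc m * n * volume.real (Metric.closedBall (0 : Space d) s)
      = ∫ _ in Metric.closedBall (z - b) s, m * n := by
        rw [hv, setIntegral_const, smul_eq_mul, mul_comm]
    _ ≤ ∫ y in Metric.closedBall (z - b) s, F y * H (z - y) := by
        refine setIntegral_mono_on (integrableOn_const (measure_closedBall_lt_top.ne))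
          hi.integrableOn Metric.isClosed_closedBall.measurableSet fun y hy => ?_
        rw [mem_closedBall_iff_norm] at hy
        refine mul_le_mul (hFm y ?_) (hHn _ ?_) hn (hF _)
        · calc ‖y - a‖ = ‖(z - (a + b)) + (y - (z - b))‖ := by congr 1; abel
            _ ≤ _ := (norm_add_le _ _).trans (add_le_add hz hy)
        · rw [← norm_neg]
          refine le_trans (le_of_eq ?_) hy
          congr 1; abel
    _ ≤ ∫ y, F y * H (z - y) :=
        setIntegral_le_integral hi (Eventually.of_forall fun y => mul_nonneg (hF _) (hH _))

/-- Frequencies near `v` and `2v` interact to give the frequency `0 = v - 2v + v`. For more than three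
factors, the remaining pairs contribute `v - v = 0`. -/
theorem le_realConvPow {d : ℕ} {G : Space d → ℝ} {K : ℝ} (hG : IsEnvelope G K)
    {F : Space d → ℝ} (hFc : Continuous F) (hF : ∀ x, 0 ≤ F x) {r₀ : ℝ}
    (hFG : ∀ x, F x ≤ r₀ * G x) {v : Space d} {m s : ℝ} (hm : 0 ≤ m) (hs : 0 ≤ s)
    (h1 : ∀ x, ‖x - v‖ ≤ 3 * s → m ≤ F x) (h2 : ∀ x, ‖x - (2 : ℤ) • v‖ ≤ 3 * s → m ≤ F x)
    (k : ℕ) {x : Space d} (hx : ‖x‖ ≤ s) :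
    m ^ (2 * (k + 1) + 1) * volume.real (Metric.closedBall (0 : Space d) s) ^ (2 * (k + 1)) ≤
      realConvPow (k + 1) F x := by
  set V := volume.real (Metric.closedBall (0 : Space d) s)
  have hV : 0 ≤ V := measureReal_nonneg
  have hr₀ : 0 ≤ r₀ := nonneg_of_mul_nonneg_left ((hF 0).trans (hFG 0)) (hG.pos 0)
  have hK := hG.K_nonneg
  set f : Space d → ℂ := fun x => (F x : ℂ) with hf
  have hfc : Continuous f := Complex.continuous_ofReal.comp hFc
  have hic : Continuous (invol f) := Complex.continuous_conj.comp (hfc.comp continuous_neg)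
  have hfG : ∀ x, ‖f x‖ ≤ r₀ * G x := fun x => by
    rw [hf, Complex.norm_real, Real.norm_of_nonneg (hF x)]; exact hFG x
  have hinv : invol f = fun x => (F (-x) : ℂ) := by ext x; simp [invol, hf]
  have hre : ∀ {A B : Space d → ℝ} {x : Space d},
      Integrable (fun y => (A y : ℂ) * (B (x - y) : ℂ)) → Integrable fun y => A y * B (x - y) :=
    fun {A B x} h => by simpa using h.re
  set q := realConv F fun x => F (-x)
  have hq0 : ∀ x, 0 ≤ q x := realConv_nonneg hF fun x => hF _
  have hqc : conv f (invol f) = fun x => (q x : ℂ) := by rw [hinv, hf, conv_ofReal]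
  have hqcont : Continuous (conv f (invol f)) :=
    (hG.continuous_conv (f := fun _ => f) (g := fun _ => invol f) hr₀ (hfc.comp continuous_snd)
      (hic.comp continuous_snd) (fun _ => hfG) (fun _ => hG.norm_invol_le hfG)).comp
      (f := fun x => ((0 : ℝ), x)) (by fun_prop)
  have hi1 : ∀ x, Integrable fun y => F y * F (-(x - y)) := fun x => by
    have := hG.integrable_conv hr₀ hfc hic hfG (hG.norm_invol_le hfG) x
    rw [hinv] at this
    exact hre (A := F) (B := fun x => F (-x)) this
  have hi2 : ∀ k x, Integrable fun y => q y * realConvPow k F (x - y) := fun k x => by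
    have := hG.integrable_conv (r := K * r₀ * r₀) (by positivity) hqcont
      (hG.continuous_convPow_apply hfc hfG k)
      (hG.norm_conv_le hr₀ hfG (hG.norm_invol_le hfG)) (hG.norm_convPow_le hfG k) x
    rw [hqc, hf, convPow_ofReal] at this
    exact hre this
  have hneg : ∀ w : Space d, (∀ x, ‖x - w‖ ≤ 3 * s → m ≤ F x) →
      ∀ x, ‖x - (-w)‖ ≤ s → m ≤ F (-x) := fun w hw x hxw => by
    refine hw _ ?_
    rw [← norm_neg]
    refine le_trans (le_of_eq ?_) (hxw.trans (by linarith : s ≤ 3 * s))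
    congr 1; abel
  have hFr : ∀ x, ‖x - v‖ ≤ 2 * s + s → m ≤ F x := fun x hx => h1 x (by linarith)
  -- `q`, the transform of `|ψ|²`, lives at the frequencies `v - v = 0` and `v - 2v = -v`
  have hqz : ∀ x, ‖x - 0‖ ≤ s + s → m * m * V ≤ q x := fun x hx =>
    le_realConv (b := -v) (r := 2 * s) hF (fun x => hF _) hm hFr (hneg v h1) (hi1 x) (by
      rw [add_neg_cancel]; linarith)
  have hqv : ∀ x, ‖x - (-v)‖ ≤ s + s → m * m * V ≤ q x := fun x hx =>
    le_realConv (b := -((2 : ℤ) • v)) (r := 2 * s) hF (fun x => hF _) hm hFr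
      (hneg _ h2) (hi1 x) (by
      rw [show v + -((2 : ℤ) • v) = -v by rw [two_zsmul]; abel]; linarith)
  induction k generalizing x with
  | zero =>
    refine le_trans (le_of_eq ?_) (le_realConv (b := v) hq0 hF hm hqv
      (fun x hx => h1 x (by linarith)) (hi2 0 x) (r := s) (by rwa [neg_add_cancel, sub_zero]))
    ring
  | succ k ih =>
    refine le_trans (le_of_eq ?_) (le_realConv (b := 0) hq0 (realConvPow_nonneg hF _)
      (by positivity) hqz
      (fun x hx => ih (x := x) (by simpa using hx)) (hi2 (k + 1) x) (r := s)
      (by rwa [add_zero, sub_zero]))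
    ring

/-! ### Data at high frequency -/

/-- The tent function of height `1` on the unit ball. -/
def tent {d : ℕ} (x : Space d) : ℝ := max 0 (1 - ‖x‖)

/-- The Fourier transform of the data: tents of height `R` and width `A` at `v` and `2v`. -/
def dataFun {d : ℕ} (R A : ℝ) (v : Space d) (x : Space d) : ℝ :=
  R * (tent (A⁻¹ • (x - v)) + tent (A⁻¹ • (x - (2 : ℤ) • v)))

section Data

variable {d : ℕ} {R A : ℝ} {v : Space d}

theorem tent_nonneg (x : Space d) : 0 ≤ tent x := le_max_left _ _

theorem tent_le_one (x : Space d) : tent x ≤ 1 :=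
  max_le zero_le_one (by linarith [norm_nonneg x])

theorem tent_eq_zero (hA : 0 < A) {x : Space d} (hx : A < ‖x‖) : tent (A⁻¹ • x) = 0 := by
  refine max_eq_left ?_
  rw [norm_smul, norm_inv, Real.norm_of_nonneg hA.le, sub_nonpos, ← div_eq_inv_mul,
    one_le_div₀ hA]
  exact hx.le

theorem half_le_tent (hA : 0 < A) {x : Space d} (hx : ‖x‖ ≤ A / 2) : 1 / 2 ≤ tent (A⁻¹ • x) := by
  refine le_trans ?_ (le_max_right _ _)
  rw [norm_smul, norm_inv, Real.norm_of_nonneg hA.le]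
  have : A⁻¹ * ‖x‖ ≤ 1 / 2 := by
    rw [inv_mul_le_iff₀ hA]; linarith
  linarith

theorem continuous_dataFun : Continuous (dataFun R A v) := by
  unfold dataFun tent; fun_prop

theorem dataFun_nonneg (hR : 0 ≤ R) (x : Space d) : 0 ≤ dataFun R A v x :=
  mul_nonneg hR (add_nonneg (tent_nonneg _) (tent_nonneg _))

theorem dataFun_le (hR : 0 ≤ R) (x : Space d) : dataFun R A v x ≤ 2 * R := by
  unfold dataFun
  nlinarith [tent_le_one (A⁻¹ • (x - v)), tent_le_one (A⁻¹ • (x - (2 : ℤ) • v))]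

theorem dataFun_eq_zero (hA : 0 < A) {x : Space d} (h1 : A < ‖x - v‖)
    (h2 : A < ‖x - (2 : ℤ) • v‖) : dataFun R A v x = 0 := by
  simp [dataFun, tent_eq_zero hA h1, tent_eq_zero hA h2]

theorem half_le_dataFun (hR : 0 ≤ R) (hA : 0 < A) {x : Space d}
    (h : ‖x - v‖ ≤ A / 2 ∨ ‖x - (2 : ℤ) • v‖ ≤ A / 2) : R / 2 ≤ dataFun R A v x := by
  unfold dataFun
  have h1 := tent_nonneg (A⁻¹ • (x - v))
  have h2 := tent_nonneg (A⁻¹ • (x - (2 : ℤ) • v))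
  rcases h with h | h
  · nlinarith [half_le_tent hA h]
  · nlinarith [half_le_tent hA h]

/-- The centres `v` and `2v` carry the weights `1/2` and `1/5` in the envelope, whence the constant. -/
theorem dataFun_le_envelope (hR : 0 ≤ R) (hA : 0 < A) (x : Space d) :
    dataFun R A v x ≤ 10 * latticeSum * 2 ^ d * R * envelope A v x := by
  have hS := latticeSum_pos
  have key : ∀ j : ℤ, 1 / 5 ≤ latticeWeight j → ‖x - j • v‖ ≤ A →
      dataFun R A v x ≤ 10 * latticeSum * 2 ^ d * R * envelope A v x := fun j hj h => by
    have h1 := le_envelope_of_norm_sub_le v hA h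
    have h2 : latticeSum⁻¹ * (1 / 5) * (2 ^ d)⁻¹ ≤ envelope A v x := by
      refine le_trans ?_ h1
      gcongr
    calc dataFun R A v x ≤ 2 * R := dataFun_le hR x
      _ = 10 * latticeSum * 2 ^ d * R * (latticeSum⁻¹ * (1 / 5) * (2 ^ d)⁻¹) := by
        field_simp; ring
      _ ≤ _ := by gcongr
  by_cases h1 : ‖x - v‖ ≤ A
  · exact key 1 (by norm_num [latticeWeight]) (by simpa using h1)
  by_cases h2 : ‖x - (2 : ℤ) • v‖ ≤ A
  · exact key 2 (by norm_num [latticeWeight]) h2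
  rw [dataFun_eq_zero hA (not_le.1 h1) (not_le.1 h2)]
  have := envelope_pos v A x
  positivity

/-- The support of the data is where `|x| ≤ 3|v|`. -/
theorem dataFun_eq_zero_of_lt (hA : 0 < A) (hAv : A ≤ ‖v‖) {x : Space d}
    (h : 3 * ‖v‖ < ‖x‖) : dataFun R A v x = 0 := by
  have h0 : ‖(2 : ℤ) • v‖ ≤ 2 * ‖v‖ := by
    rw [two_zsmul, two_mul]; exact norm_add_le _ _
  refine dataFun_eq_zero hA ?_ ?_
  · have := norm_sub_norm_le x v
    linarith
  · have := norm_sub_norm_le x ((2 : ℤ) • v)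
    linarith

/-- The data vanishes near the zero frequency. -/
theorem dataFun_eq_zero_of_le (hA : 0 < A) (hAv : 4 * A ≤ ‖v‖) {x : Space d}
    (h : ‖x‖ ≤ A) : dataFun R A v x = 0 := by
  have h0 : ‖(2 : ℤ) • v‖ = 2 * ‖v‖ := by
    rw [two_zsmul, ← two_smul ℝ, norm_smul]; norm_num
  refine dataFun_eq_zero hA ?_ ?_
  · have := norm_sub_norm_le v x
    rw [norm_sub_rev] at this
    linarith
  · have := norm_sub_norm_le ((2 : ℤ) • v) x
    rw [norm_sub_rev] at this
    linarith

end Data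

/-! ### Growth at low frequencies -/

theorem IsEnvelope.memLp_of_norm_le {d : ℕ} {G : Space d → ℝ} {K : ℝ} (hG : IsEnvelope G K)
    {f : Space d → ℂ} {r : ℝ} (hfc : Continuous f) (hf : ∀ x, ‖f x‖ ≤ r * G x) {q : ℝ≥0∞}
    (hq : 1 ≤ q) : MemLp f q := by
  have hGq : MemLp G q := by
    rcases eq_or_ne q ∞ with rfl | hq'
    · refine memLp_top_of_bound hG.continuous.aestronglyMeasurable 1
        (Eventually.of_forall fun x => ?_)
      rw [Real.norm_of_nonneg (hG.pos x).le]
      exact hG.le_one x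
    · have h1 : 1 ≤ q.toReal := by
        rw [← ENNReal.toReal_one]
        exact ENNReal.toReal_mono hq' hq
      rw [← integrable_norm_rpow_iff hG.continuous.aestronglyMeasurable (by positivity) hq']
      refine hG.integrable.mono' (Continuous.aestronglyMeasurable
        (hG.continuous.norm.rpow_const fun x => Or.inr (by linarith)))
        (Eventually.of_forall fun x => ?_)
      rw [Real.norm_of_nonneg (hG.pos x).le, Real.norm_of_nonneg
        (Real.rpow_nonneg (hG.pos x).le _)]
      exact (Real.rpow_le_rpow_of_exponent_ge (hG.pos x) (hG.le_one x) h1).trans_eq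
        (Real.rpow_one _)
  exact (hGq.const_mul r).of_le hfc.aestronglyMeasurable
    (Eventually.of_forall fun x => (hf x).trans (Real.le_norm_self _))

theorem norm_phase_mul_sub_le {d : ℕ} {f : Space d → ℂ} {N C t : ℝ} {x : Space d} (ht : 0 ≤ t)
    (hN : f x ≠ 0 → ‖x‖ ≤ N) (hf : ‖f x‖ ≤ C) :
    ‖phase t x * f x - f x‖ ≤ 2 * Real.pi ^ 2 * t * N ^ 2 * C := by
  have hC : 0 ≤ C := (norm_nonneg _).trans hf
  by_cases h0 : f x = 0
  · rw [h0]; simp; positivity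
  · rw [← sub_one_mul, norm_mul]
    have h1 := norm_phase_sub_one_le t x
    rw [abs_of_nonneg ht] at h1
    have h2 := hN h0
    refine mul_le_mul (h1.trans ?_) hf (norm_nonneg _) (by positivity)
    gcongr

/-- A solution stays close to its data as long as the phases of the linear evolution do not rotate
and the nonlinear contribution is small. -/
theorem IsEnvelope.norm_sub_data_le {d : ℕ} {G : Space d → ℝ} {K : ℝ} (hG : IsEnvelope G K)
    (σ : ℕ) {μ : ℝ} (hμ : |μ| ≤ 1) {u₀ : Space d → ℂ} {r₀ r N T : ℝ} (hr₀ : 0 ≤ r₀)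
    (hN : ∀ x, u₀ x ≠ 0 → ‖x‖ ≤ N) (hu₀ : ∀ x, ‖u₀ x‖ ≤ r₀ * G x) {u : ℝ → Space d → ℂ}
    (hu : ∀ t x, ‖u t x‖ ≤ r * G x)
    (heq : ∀ t ∈ Set.Icc 0 T, ∀ x, u t x = duhamelMap σ μ u₀ u t x) {t : ℝ}
    (ht : t ∈ Set.Icc 0 T) (x : Space d) :
    ‖u t x - u₀ x‖ ≤
      (2 * Real.pi ^ 2 * T * N ^ 2 * r₀ + T * (r * K) ^ (2 * σ) * r) * G x := by
  have hr := hG.nonneg_of_norm_le (hu 0)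
  have hK := hG.K_nonneg
  have hGx := (hG.pos x).le
  have h1 := norm_phase_mul_sub_le ht.1 (hN x) (hu₀ x)
  have h2 := hG.norm_integral_integrand_le σ hu ht.1 x
  have h3 : ‖(Complex.I * (μ : ℂ)) * ∫ τ in (0 : ℝ)..t, phase (t - τ) x * convPow σ (u τ) x‖ ≤
      t * (r * K) ^ (2 * σ) * r * G x := by
    rw [norm_mul, norm_mul, Complex.norm_I, one_mul, Complex.norm_real, Real.norm_eq_abs]
    exact (mul_le_of_le_one_left (norm_nonneg _) hμ).trans h2
  rw [heq t ht x, duhamelMap, sub_right_comm]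
  refine (norm_sub_le _ _).trans ((add_le_add h1 h3).trans ?_)
  have h4 : 2 * Real.pi ^ 2 * t * N ^ 2 * (r₀ * G x) ≤
      2 * Real.pi ^ 2 * T * N ^ 2 * (r₀ * G x) := by
    gcongr; exact ht.2
  have h5 : t * (r * K) ^ (2 * σ) * r * G x ≤ T * (r * K) ^ (2 * σ) * r * G x := by
    gcongr; exact ht.2
  linarith

/-- Where the data vanishes, the solution is the first Picard iterate `-iμT P(u₀)`, up to errors
that are of higher order in the strength of the nonlinearity, or small with the phases. -/
theorem IsEnvelope.le_norm_of_data_eq_zero {d : ℕ} {G : Space d → ℝ} {K : ℝ}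
    (hG : IsEnvelope G K) (σ : ℕ) {μ : ℝ} (hμ : |μ| = 1) {u₀ : Space d → ℂ}
    (hu₀c : Continuous u₀) {r₀ N T : ℝ} (hr₀ : 0 ≤ r₀) (hT : 0 ≤ T)
    (hN : ∀ x, u₀ x ≠ 0 → ‖x‖ ≤ N) (hu₀ : ∀ x, ‖u₀ x‖ ≤ r₀ * G x) {u : ℝ → Space d → ℂ}
    (huc : Continuous (Function.uncurry u)) (hu : ∀ t x, ‖u t x‖ ≤ 2 * r₀ * G x)
    (heq : ∀ t ∈ Set.Icc 0 T, ∀ x, u t x = duhamelMap σ μ u₀ u t x) {x : Space d}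
    (hx : u₀ x = 0) (hxN : ‖x‖ ≤ N) {ρ κ : ℝ} (hρ : T * (r₀ * K) ^ (2 * σ) = ρ)
    (hκ : 2 * Real.pi ^ 2 * T * N ^ 2 = κ) :
    T * ‖convPow σ u₀ x‖ -
      ρ * r₀ * ((2 * σ + 1) * 4 ^ σ * (κ + 2 * 4 ^ σ * ρ) + κ) ≤ ‖u T x‖ := by
  have hK := hG.K_nonneg
  have hκ0 : 0 ≤ κ := by rw [← hκ]; positivity
  have hρ0 : 0 ≤ ρ := by rw [← hρ]; positivity
  have hc : ∀ t, Continuous (u t) := fun t => huc.comp (f := fun x => (t, x)) (by fun_prop)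
  have h4 : (2 * r₀ * K) ^ (2 * σ) = 4 ^ σ * (r₀ * K) ^ (2 * σ) := by
    rw [mul_assoc, mul_pow, pow_mul 2 2 σ]; norm_num
  have hdiff : ∀ t ∈ Set.Icc 0 T, ∀ x, ‖u t x - u₀ x‖ ≤ ((κ + 2 * 4 ^ σ * ρ) * r₀) * G x := by
    intro t ht x
    refine (hG.norm_sub_data_le σ hμ.le hr₀ hN hu₀ hu heq ht x).trans (le_of_eq ?_)
    rw [h4, hκ, ← hρ]; ring
  have hu₀' : ∀ x, ‖u₀ x‖ ≤ 2 * r₀ * G x := fun x => (hu₀ x).trans (by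
    have := (hG.pos x).le
    gcongr; linarith)
  set P₀ := convPow σ u₀ x
  set e := (r₀ * K) ^ (2 * σ) * r₀ * ((2 * σ + 1) * 4 ^ σ * (κ + 2 * 4 ^ σ * ρ) + κ)
  have hpt : ∀ τ ∈ Set.Icc 0 T, ‖phase (T - τ) x * convPow σ (u τ) x - P₀‖ ≤ e := by
    intro τ hτ
    have h1 : ‖convPow σ (u τ) x - P₀‖ ≤
        (2 * σ + 1) * (2 * r₀ * K) ^ (2 * σ) * ((κ + 2 * 4 ^ σ * ρ) * r₀) := by
      refine (hG.norm_convPow_sub_le (by positivity) (hc τ) hu₀c (hu τ) hu₀' (hdiff τ hτ) σ x).trans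
        (mul_le_of_le_one_right (by positivity) (hG.le_one x))
    have h2 : ‖phase (T - τ) x * P₀ - P₀‖ ≤ κ * ((r₀ * K) ^ (2 * σ) * r₀) := by
      refine (norm_phase_mul_sub_le (sub_nonneg.2 hτ.2) (f := convPow σ u₀) (fun _ => hxN)
        ((hG.norm_convPow_le hu₀ σ x).trans
          (mul_le_of_le_one_right (by positivity) (hG.le_one x)))).trans ?_
      rw [← hκ]
      gcongr
      linarith [hτ.1]
    calc _ = ‖phase (T - τ) x * (convPow σ (u τ) x - P₀) + (phase (T - τ) x * P₀ - P₀)‖ := by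
          congr 1; ring
      _ ≤ (2 * σ + 1) * (2 * r₀ * K) ^ (2 * σ) * ((κ + 2 * 4 ^ σ * ρ) * r₀) +
          κ * ((r₀ * K) ^ (2 * σ) * r₀) := by
          refine (norm_add_le _ _).trans (add_le_add ?_ h2)
          rwa [norm_mul, norm_phase, one_mul]
      _ = e := by rw [h4]; ring
  have hint : IntervalIntegrable (fun τ => phase (T - τ) x * convPow σ (u τ) x) volume 0 T :=
    ((hG.continuous_integrand σ huc hu).comp
      (f := fun τ : ℝ => ((T, x), τ)) (by fun_prop)).intervalIntegrable _ _
  have hnorm : ‖u T x‖ = ‖∫ τ in (0 : ℝ)..T, phase (T - τ) x * convPow σ (u τ) x‖ := by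
    rw [heq T ⟨hT, le_rfl⟩ x, duhamelMap, hx, mul_zero, zero_sub, norm_neg, norm_mul, norm_mul,
      Complex.norm_I, one_mul, Complex.norm_real, Real.norm_eq_abs, hμ, one_mul]
  have hsub : ‖(∫ τ in (0 : ℝ)..T, phase (T - τ) x * convPow σ (u τ) x) - (T : ℂ) * P₀‖ ≤
      e * T := by
    have : (∫ τ in (0 : ℝ)..T, phase (T - τ) x * convPow σ (u τ) x) - (T : ℂ) * P₀ =
        ∫ τ in (0 : ℝ)..T, (phase (T - τ) x * convPow σ (u τ) x - P₀) := by
      rw [intervalIntegral.integral_sub hint (by simp), intervalIntegral.integral_const, sub_zero,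
        Complex.real_smul]
    rw [this]
    refine (intervalIntegral.norm_integral_le_of_norm_le_const fun τ hτ => hpt τ ?_).trans
      (le_of_eq ?_)
    · rw [Set.uIoc_of_le hT] at hτ
      exact ⟨hτ.1.le, hτ.2⟩
    · rw [sub_zero, abs_of_nonneg hT]
  have htri := norm_sub_norm_le ((T : ℂ) * P₀)
    (∫ τ in (0 : ℝ)..T, phase (T - τ) x * convPow σ (u τ) x)
  rw [norm_sub_rev, norm_mul, Complex.norm_real, Real.norm_of_nonneg hT] at htri
  rw [hnorm]
  have he : e * T = ρ * r₀ * ((2 * σ + 1) * 4 ^ σ * (κ + 2 * 4 ^ σ * ρ) + κ) := by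
    simp only [e, ← hρ]; ring
  linarith

/-- The Fourier transform of the data as a complex-valued function. -/
def dataHat {d : ℕ} (R A : ℝ) (v : Space d) (x : Space d) : ℂ := (dataFun R A v x : ℂ)

/-- The quantitative growth result. With data of height `R` and width `A` at the frequencies `v` and
`2v`, the strength `T (R A^d)^{2σ}` of the nonlinearity on `[0, T]` is a small constant and `T|v|²`
is small. Then the solution at time `T` has height `≳ R` on a ball of radius `≳ A` around the zero
frequency. -/
theorem exists_solution_with_growth {d σ : ℕ} (hd : 1 ≤ d) (hσ : 1 ≤ σ) :
    ∃ D ρ κ c : ℝ, 0 < D ∧ 0 < ρ ∧ 0 < κ ∧ 0 < c ∧ ∀ (μ A R T : ℝ) (v : Space d), |μ| = 1 →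
      0 < A → 0 < R → 0 < T → 4 * A ≤ ‖v‖ → T * (D * (R * A ^ d)) ^ (2 * σ) = ρ →
      T * ‖v‖ ^ 2 ≤ κ → ∃ (hm₀ : MemLp (dataHat R A v) 2)
        (u : ℝ → Space d → ℂ) (hm : ∀ t, MemLp (u t) 2),
        IsSolution σ μ T (ofFourier (dataHat R A v) hm₀) (fun t => ofFourier (u t) (hm t)) ∧
        (∀ t, ∀ q : ℝ≥0∞, 1 ≤ q → MemLp (u t) q) ∧ ∀ x, ‖x‖ ≤ A / 6 → c * R ≤ ‖u T x‖ := by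
  set I := ∫ x : Space d, profile x with hI
  have hI0 : 0 < I := integral_profile_pos hd
  have hS := latticeSum_pos
  -- `c₁ R` is the size of the data relative to the envelope, and `D (R A^d) = c₁ R K`
  set c₁ : ℝ := 10 * latticeSum * 2 ^ d with hc₁
  have hc₁0 : 0 < c₁ := by positivity
  set D : ℝ := c₁ * (16 * 4 ^ d * I) with hD
  have hD0 : 0 < D := by positivity
  set ω := volume.real (Metric.ball (0 : Space d) 1) with hω
  have hω0 : 0 < ω := ENNReal.toReal_pos (Metric.measure_ball_pos _ _ one_pos).ne'
    measure_ball_lt_top.ne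
  -- `ρ m R` is the height of the first iterate; `ρ` and `κ` make the error at most half of it
  set m : ℝ := (1 / 2) ^ (2 * σ + 1) * (ω / 6 ^ d / D) ^ (2 * σ) with hm
  have hm0 : 0 < m := by positivity
  set E : ℝ := (2 * σ + 1) * 4 ^ σ with hE
  have hE0 : 0 < E := by positivity
  set ρ : ℝ := min (1 / (2 * E)) (m / (8 * c₁ * E * 4 ^ σ)) with hρ
  have hρ0 : 0 < ρ := by positivity
  set κ : ℝ := m / (72 * Real.pi ^ 2 * c₁ * (E + 1)) with hκ
  have hκ0 : 0 < κ := by positivity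
  refine ⟨D, ρ, κ, ρ * m / 2, hD0, hρ0, hκ0, by positivity, ?_⟩
  intro μ A R T v hμ hA hR hT hAv hTρ hTκ
  have hG := isEnvelope_envelope v hd hA
  rw [← hI] at hG
  set K := 16 * 4 ^ d * I * A ^ d with hK
  set u₀ : Space d → ℂ := dataHat R A v with hu₀
  have hu₀c : Continuous u₀ := Complex.continuous_ofReal.comp continuous_dataFun
  have hu₀b : ∀ x, ‖u₀ x‖ ≤ c₁ * R * envelope A v x := fun x => by
    rw [hu₀, dataHat, Complex.norm_real, Real.norm_of_nonneg (dataFun_nonneg hR.le x)]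
    exact dataFun_le_envelope hR.le hA x
  have hρ' : T * (c₁ * R * K) ^ (2 * σ) = ρ := by
    rw [← hTρ]; congr 2; rw [hK, hD]; ring
  have hEρ : E * ρ ≤ 1 / 2 := by
    calc E * ρ ≤ E * (1 / (2 * E)) := by gcongr; exact min_le_left _ _
      _ = _ := by field_simp
  have hsmall : (2 * σ + 1) * (T * (2 * (c₁ * R) * K) ^ (2 * σ)) ≤ 1 / 2 := by
    refine le_trans (le_of_eq ?_) hEρ
    rw [← hρ', mul_assoc 2, mul_pow 2, pow_mul 2 2 σ, hE]
    norm_num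
    ring
  obtain ⟨u, huc, hu, heq⟩ := hG.exists_eq_duhamelMap σ hμ.le hu₀c hu₀b hT.le hsmall
  have hc : ∀ t, Continuous (u t) := fun t => huc.comp (f := fun x => (t, x)) (by fun_prop)
  refine ⟨hG.memLp_two_of_norm_le hu₀c hu₀b, u, fun t => hG.memLp_two_of_norm_le (hc t) (hu t),
    hG.isSolution_ofFourier σ _ huc hu _ heq,
    fun t q hq => hG.memLp_of_norm_le (hc t) (hu t) hq, fun x hx => ?_⟩
  have hvN : A ≤ ‖v‖ := by linarith
  have hN : ∀ x, u₀ x ≠ 0 → ‖x‖ ≤ 3 * ‖v‖ := fun x hx => by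
    by_contra hlt
    exact hx (by simp [hu₀, dataHat, dataFun_eq_zero_of_lt hA hvN (not_le.1 hlt)])
  have hx0 : u₀ x = 0 := by
    simp [hu₀, dataHat, dataFun_eq_zero_of_le hA hAv (by linarith : ‖x‖ ≤ A)]
  have key := hG.le_norm_of_data_eq_zero σ hμ hu₀c (by positivity) hT.le hN hu₀b huc hu heq hx0
    (by linarith) hρ' rfl
  refine le_trans ?_ key
  set κ' := 2 * Real.pi ^ 2 * T * (3 * ‖v‖) ^ 2 with hκ'
  have hκ'0 : 0 ≤ κ' := by positivity
  have hκle : κ' ≤ m / (4 * c₁ * (E + 1)) := by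
    calc κ' = 18 * Real.pi ^ 2 * (T * ‖v‖ ^ 2) := by rw [hκ']; ring
      _ ≤ 18 * Real.pi ^ 2 * κ := by gcongr
      _ = _ := by rw [hκ]; field_simp; norm_num
  have hmain : ρ * R * m ≤ T * ‖convPow σ u₀ x‖ := by
    obtain ⟨k, rfl⟩ : ∃ k, σ = k + 1 := ⟨σ - 1, by omega⟩
    have h := le_realConvPow hG continuous_dataFun (dataFun_nonneg hR.le)
      (dataFun_le_envelope hR.le hA) (v := v) (m := R / 2) (s := A / 6) (by positivity)
      (by positivity)
      (fun x hx => half_le_dataFun hR.le hA (Or.inl (by linarith)))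
      (fun x hx => half_le_dataFun hR.le hA (Or.inr (by linarith))) k hx
    rw [hu₀, show dataHat R A v = fun x => (dataFun R A v x : ℂ) from rfl, convPow_ofReal,
      Complex.norm_real, Real.norm_of_nonneg (realConvPow_nonneg (dataFun_nonneg hR.le) _ _)]
    refine le_trans (le_of_eq ?_) (mul_le_mul_of_nonneg_left h hT.le)
    rw [measureReal_def, Measure.addHaar_closedBall _ _ (by positivity), ENNReal.toReal_mul,
      ← measureReal_def, ← hω, finrank_euclideanSpace_fin, ENNReal.toReal_ofReal (by positivity),
      ← hTρ, hm]
    have e : D * (R * A ^ d) * (ω / 6 ^ d / D) = R * ((A / 6) ^ d * ω) := by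
      rw [div_pow]; field_simp
    have e' := congrArg (fun y => y ^ (2 * (k + 1))) e
    simp only [mul_pow _ _ (2 * (k + 1))] at e' ⊢
    rw [div_pow R, one_div_pow, pow_succ R]
    linear_combination (T * R * (2 ^ (2 * (k + 1) + 1))⁻¹) * e'
  have herr : c₁ * (E * (κ' + 2 * 4 ^ σ * ρ) + κ') ≤ m / 2 := by
    have h1 : c₁ * (E + 1) * κ' ≤ m / 4 := by
      calc c₁ * (E + 1) * κ' ≤ c₁ * (E + 1) * (m / (4 * c₁ * (E + 1))) := by gcongr
        _ = _ := by field_simp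
    have h2 : c₁ * E * (2 * 4 ^ σ) * ρ ≤ m / 4 := by
      calc c₁ * E * (2 * 4 ^ σ) * ρ ≤ c₁ * E * (2 * 4 ^ σ) * (m / (8 * c₁ * E * 4 ^ σ)) := by
            gcongr; exact min_le_right _ _
        _ = _ := by field_simp; norm_num
    linarith
  have h3 : ρ * (c₁ * R) * (E * (κ' + 2 * 4 ^ σ * ρ) + κ') ≤ ρ * R * (m / 2) := by
    calc _ = ρ * R * (c₁ * (E * (κ' + 2 * 4 ^ σ * ρ) + κ')) := by ring
      _ ≤ _ := by gcongr
  linarith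

/-! ### Fourier-Lebesgue norms of the data and of the solution -/

theorem volume_preimage_closedBall {d : ℕ} (a : Space d) {A : ℝ} (hA : 0 ≤ A) :
    volume ((fun ξ : Space d => (2 * Real.pi)⁻¹ • ξ) ⁻¹' Metric.closedBall a A) =
      ENNReal.ofReal ((2 * Real.pi) ^ d * volume.real (Metric.ball (0 : Space d) 1) * A ^ d) := by
  rw [Measure.addHaar_preimage_smul _ (by positivity), Measure.addHaar_closedBall _ _ hA,
    finrank_euclideanSpace_fin, ← ofReal_measureReal measure_ball_lt_top.ne,
    ← ENNReal.ofReal_mul (by positivity), ← ENNReal.ofReal_mul (by positivity), inv_pow, inv_inv,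
    abs_of_pos (by positivity)]
  congr 1
  ring

theorem ofReal_mul_pow_rpow {C A q : ℝ} (hC : 0 ≤ C) (hA : 0 ≤ A) (hq : 0 ≤ q) (d : ℕ) :
    ENNReal.ofReal (C * A ^ d) ^ q = ENNReal.ofReal (C ^ q * A ^ (d * q)) := by
  rw [ENNReal.ofReal_rpow_of_nonneg (by positivity) hq, Real.mul_rpow hC (by positivity),
    ← Real.rpow_natCast, ← Real.rpow_mul hA]

/-- The norm of the data, `≲ R |v|^s A^{d/p}`. -/
theorem flNorm_data_le {d : ℕ} (p : ℝ≥0∞) {s A R : ℝ} (hs : s ≤ 0) (hA : 0 < A) (hR : 0 < R)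
    {v : Space d} (hAv : 4 * A ≤ ‖v‖) (hm : MemLp (dataHat R A v) 2) :
    flNorm p s (ofFourier (dataHat R A v) hm : 𝓢'(Space d, ℂ)) ≤
      ENNReal.ofReal (2 * (2 * ((2 * Real.pi) ^ d * volume.real (Metric.ball (0 : Space d) 1))) ^
        (p⁻¹).toReal * (R * ‖v‖ ^ s * A ^ (d * (p⁻¹).toReal))) := by
  set ω := volume.real (Metric.ball (0 : Space d) 1)
  have hω : 0 ≤ ω := measureReal_nonneg
  have hv : 0 < ‖v‖ := by linarith
  have hpi : 0 < 2 * Real.pi := by positivity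
  set Ω := (fun ξ : Space d => (2 * Real.pi)⁻¹ • ξ) ⁻¹'
    (Metric.closedBall v A ∪ Metric.closedBall ((2 : ℤ) • v) A) with hΩ
  have hΩv : volume Ω ≤ ENNReal.ofReal (2 * ((2 * Real.pi) ^ d * ω) * A ^ d) := by
    rw [hΩ, Set.preimage_union]
    refine (measure_union_le _ _).trans (le_of_eq ?_)
    rw [volume_preimage_closedBall _ hA.le, volume_preimage_closedBall _ hA.le,
      ← ENNReal.ofReal_add (by positivity) (by positivity)]
    congr 1; ring
  rw [flNorm_eq (hasFourierDensity_ofFourier hm)]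
  have h2v : ‖(2 : ℤ) • v‖ = 2 * ‖v‖ := by
    rw [two_zsmul, ← two_smul ℝ, norm_smul]; norm_num
  have hpt : ∀ ξ : Space d, ‖(((1 + ‖ξ‖ ^ 2) ^ (s / 2) : ℝ) : ℂ) * rescale (dataHat R A v) ξ‖ ≤
      ‖Ω.indicator (fun _ => ‖v‖ ^ s * (2 * R)) ξ‖ := by
    intro ξ
    by_cases hξ : ξ ∈ Ω
    · rw [Set.indicator_of_mem hξ, Real.norm_of_nonneg (by positivity), norm_mul]
      -- in the variable `ξ` the data lives at `|ξ| ≥ 2π · (3/4) |v| ≥ |v|`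
      have h1 : 3 / 4 * ‖v‖ ≤ ‖(2 * Real.pi)⁻¹ • ξ‖ := by
        rcases hξ with h | h <;> rw [mem_closedBall_iff_norm] at h
        · have := norm_sub_norm_le v ((2 * Real.pi)⁻¹ • ξ)
          rw [norm_sub_rev] at this
          linarith
        · have := norm_sub_norm_le ((2 : ℤ) • v) ((2 * Real.pi)⁻¹ • ξ)
          rw [norm_sub_rev] at this
          linarith
      have h2 : ‖v‖ ≤ ‖ξ‖ := by
        rw [norm_smul, norm_inv, Real.norm_of_nonneg hpi.le, ← div_eq_inv_mul,
          le_div_iff₀ hpi] at h1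
        nlinarith [Real.pi_gt_three]
      refine mul_le_mul ?_ ((norm_rescale_le _ _).trans ?_) (norm_nonneg _) (by positivity)
      · rw [Complex.norm_real, Real.norm_of_nonneg (by positivity)]
        calc (1 + ‖ξ‖ ^ 2) ^ (s / 2) ≤ (‖v‖ ^ 2) ^ (s / 2) :=
              Real.rpow_le_rpow_of_nonpos (by positivity) (by nlinarith) (by linarith)
          _ = ‖v‖ ^ s := by
              rw [← Real.rpow_natCast, ← Real.rpow_mul hv.le]; congr 1; push_cast; ring
      · rw [dataHat, Complex.norm_real, Real.norm_of_nonneg (dataFun_nonneg hR.le _)]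
        exact dataFun_le hR.le _
    · have h0 : dataFun R A v ((2 * Real.pi)⁻¹ • ξ) = 0 := by
        have h : ¬(_ ∨ _) := hξ
        push Not at h
        refine dataFun_eq_zero hA ?_ ?_
        · exact not_le.1 fun h' => h.1 (mem_closedBall_iff_norm.2 h')
        · exact not_le.1 fun h' => h.2 (mem_closedBall_iff_norm.2 h')
      rw [Set.indicator_of_notMem hξ, rescale, dataHat, h0]
      simp
  refine (eLpNorm_mono hpt).trans ((eLpNorm_indicator_const_le _ _).trans ?_)
  rw [one_div, ← ENNReal.toReal_inv]
  refine (mul_le_mul_right (ENNReal.rpow_le_rpow hΩv ENNReal.toReal_nonneg) _).trans (le_of_eq ?_)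
  rw [ofReal_mul_pow_rpow (by positivity) hA.le ENNReal.toReal_nonneg, ← ofReal_norm,
    Real.norm_of_nonneg (by positivity), ← ENNReal.ofReal_mul (by positivity)]
  congr 1
  ring

/-- The lower bound `≳ c A^{s + d/p}` for the norm of a function whose Fourier transform has height
`c` on a ball of radius `≳ A` around the origin. -/
theorem le_flNorm_ofFourier {d : ℕ} {p : ℝ≥0∞} (hp : 1 ≤ p) {s A c : ℝ} (hs : s ≤ 0) (hA : 1 ≤ A)
    (hc : 0 ≤ c) {f : Space d → ℂ} (hm : MemLp f 2) (hf : ∀ x, ‖x‖ ≤ A / 6 → c ≤ ‖f x‖) :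
    ENNReal.ofReal (((2 * Real.pi) ^ d)⁻¹ * 2 ^ s *
        ((2 * Real.pi) ^ d * volume.real (Metric.ball (0 : Space d) 1) * (1 / 6) ^ d) ^
        (p⁻¹).toReal * (c * A ^ s * A ^ (d * (p⁻¹).toReal))) ≤
      flNorm p s (ofFourier f hm : 𝓢'(Space d, ℂ)) := by
  set ω := volume.real (Metric.ball (0 : Space d) 1)
  have hω : 0 < ω := ENNReal.toReal_pos (Metric.measure_ball_pos _ _ one_pos).ne'
    measure_ball_lt_top.ne
  have hA0 : 0 < A := by linarith
  have hpi : 0 < 2 * Real.pi := by positivity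
  set Ω := (fun ξ : Space d => (2 * Real.pi)⁻¹ • ξ) ⁻¹' Metric.closedBall 0 (A / 6) with hΩ
  have hΩm : MeasurableSet Ω := Metric.isClosed_closedBall.measurableSet.preimage (by fun_prop)
  have hΩv : volume Ω = ENNReal.ofReal ((2 * Real.pi) ^ d * ω * (1 / 6) ^ d * A ^ d) := by
    rw [hΩ, volume_preimage_closedBall _ (by positivity), div_pow, div_pow]
    congr 1; ring
  rw [flNorm_eq (hasFourierDensity_ofFourier hm)]
  set C := ((2 * Real.pi) ^ d)⁻¹ * 2 ^ s * (c * A ^ s) with hC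
  have hlow : eLpNorm (fun _ : Space d => C) p (volume.restrict Ω) ≤
      eLpNorm (fun ξ => (((1 + ‖ξ‖ ^ 2) ^ (s / 2) : ℝ) : ℂ) * rescale f ξ) p
        (volume.restrict Ω) := by
    refine eLpNorm_mono_ae ((ae_restrict_mem hΩm).mono fun ξ hξ => ?_)
    have h1 : ‖(2 * Real.pi)⁻¹ • ξ‖ ≤ A / 6 := mem_closedBall_zero_iff.1 hξ
    have h2 : ‖ξ‖ ^ 2 ≤ 3 * A ^ 2 := by
      rw [norm_smul, norm_inv, Real.norm_of_nonneg hpi.le, inv_mul_le_iff₀ hpi] at h1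
      have h3 : ‖ξ‖ ≤ 4 / 3 * A := by nlinarith [Real.pi_lt_four]
      nlinarith [norm_nonneg ξ]
    have h3 : (2 * A) ^ s ≤ (1 + ‖ξ‖ ^ 2) ^ (s / 2) := by
      calc (2 * A) ^ s = ((2 * A) ^ 2) ^ (s / 2) := by
            rw [← Real.rpow_natCast, ← Real.rpow_mul (by positivity)]; congr 1; push_cast; ring
        _ ≤ _ := Real.rpow_le_rpow_of_nonpos (by positivity) (by nlinarith) (by linarith)
    rw [Real.norm_of_nonneg (by positivity), norm_mul, Complex.norm_real,
      Real.norm_of_nonneg (by positivity), rescale, norm_mul, norm_inv, Complex.norm_real,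
      Real.norm_of_nonneg (by positivity)]
    calc C = (2 * A) ^ s * (((2 * Real.pi) ^ d)⁻¹ * c) := by
          rw [hC, Real.mul_rpow (by norm_num) hA0.le]; ring
      _ ≤ _ := by gcongr; exact hf _ h1
  refine le_trans (le_of_eq ?_) (hlow.trans (eLpNorm_mono_measure _ Measure.restrict_le_self))
  have hne : volume.restrict Ω ≠ 0 := by
    rw [Ne, Measure.restrict_eq_zero, hΩv]
    simp only [ENNReal.ofReal_eq_zero, not_le]
    positivity
  rw [eLpNorm_const _ (by positivity) hne, Measure.restrict_apply_univ, hΩv, one_div p.toReal,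
    ← ENNReal.toReal_inv, ofReal_mul_pow_rpow (by positivity) hA0.le ENNReal.toReal_nonneg,
    ← ofReal_norm, Real.norm_of_nonneg (by positivity), ← ENNReal.ofReal_mul (by positivity)]
  congr 1
  rw [hC]
  ring

theorem memFL_ofFourier {d : ℕ} {p : ℝ≥0∞} {s : ℝ} (hs : s ≤ 0) {f : Space d → ℂ}
    (hm : MemLp f 2) (hf : MemLp f p) : MemFL p s (ofFourier f hm : 𝓢'(Space d, ℂ)) := by
  rw [MemFL, flNorm_eq (hasFourierDensity_ofFourier hm)]
  have hpi : (2 * Real.pi)⁻¹ ≠ 0 := by positivity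
  have hscale : MemLp (fun ξ => f ((2 * Real.pi)⁻¹ • ξ)) p := by
    have h : MemLp f p (Measure.map (fun ξ : Space d => (2 * Real.pi)⁻¹ • ξ) volume) := by
      rw [Measure.map_addHaar_smul _ hpi]
      exact hf.smul_measure ENNReal.ofReal_ne_top
    exact h.comp_of_map (by fun_prop)
  refine (eLpNorm_mono fun ξ => ?_).trans_lt hscale.2
  rw [norm_mul, Complex.norm_real, Real.norm_of_nonneg (by positivity)]
  refine (mul_le_of_le_one_left (norm_nonneg _) ?_).trans (norm_rescale_le _ _)
  exact Real.rpow_le_one_of_one_le_of_nonpos (by nlinarith [sq_nonneg ‖ξ‖]) (by linarith)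

/-! ### Choice of the parameters -/

/-- The parameters: a frequency `N`, the width `A = N^{1-θ}`, the height `R = N^{-s-ε} A^{-dq}`, and
the time `T` at which the nonlinearity has strength `ρ`. -/
theorem exists_parameters {d σ : ℕ} (hσ : 1 ≤ σ) {q s : ℝ} (hq : 0 ≤ q) (hs : s < 0)
    (hsc : s < d * (1 - q) - 1 / σ) {D ρ κ C₁ C₂ δ : ℝ} (hD : 0 < D) (hρ : 0 < ρ) (hκ : 0 < κ)
    (hC₂ : 0 < C₂) (hδ : 0 < δ) :
    ∃ N A R T : ℝ, 0 < N ∧ 1 ≤ A ∧ 0 < R ∧ 0 < T ∧ T < δ ∧ 4 * A ≤ N ∧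
      T * (D * (R * A ^ d)) ^ (2 * σ) = ρ ∧ T * N ^ 2 ≤ κ ∧
      C₁ * (R * N ^ s * A ^ (d * q)) < δ ∧ δ⁻¹ < C₂ * (R * A ^ s * A ^ (d * q)) := by
  have hσ' : (0 : ℝ) < σ := by exact_mod_cast hσ
  have hd : (0 : ℝ) ≤ d := Nat.cast_nonneg d
  set γ := d * (1 - q) - 1 / σ - s with hγ
  have hγ0 : 0 < γ := by linarith
  set θ := min (1 / 2) (γ / (2 * (d - s))) with hθ
  have hds : 0 < d - s := by linarith
  have hθ0 : 0 < θ := by positivity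
  have hθ1 : θ ≤ 1 / 2 := min_le_left _ _
  have hθγ : θ * (d - s) ≤ γ / 2 := by
    calc θ * (d - s) ≤ γ / (2 * (d - s)) * (d - s) := by gcongr; exact min_le_right _ _
      _ = _ := by field_simp
  set ε := -(θ * s) / 2 with hε
  have hε0 : 0 < ε := by
    rw [hε]; have := mul_neg_of_pos_of_neg hθ0 hs; linarith
  -- `R A^d = N^α`, so that `T N² ~ N^{2 - 2σα}`
  set α := -s - ε + (1 - θ) * d * (1 - q) with hα
  have hασ : 1 / σ < α := by
    have h1 : 0 ≤ θ * d * q := by positivity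
    nlinarith
  have hβ : 2 - 2 * σ * α < 0 := by
    have : 1 < σ * α := by rwa [div_lt_iff₀' hσ'] at hασ
    linarith
  have key : ∀ᶠ N : ℝ in atTop, 1 ≤ N ∧ 4 ≤ N ^ θ ∧
      ρ * (D ^ (2 * σ))⁻¹ * N ^ (2 - 2 * σ * α) < min κ δ ∧ C₁ * N ^ (-ε) < δ ∧
      δ⁻¹ < C₂ * N ^ ε := by
    have hneg : ∀ {a : ℝ}, a < 0 → ∀ C : ℝ, Tendsto (fun N : ℝ => C * N ^ a) atTop (𝓝 0) :=
      fun {a} ha C => by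
        have h := (tendsto_rpow_neg_atTop (neg_pos.2 ha)).const_mul C
        rwa [neg_neg, mul_zero] at h
    filter_upwards [eventually_ge_atTop 1, (tendsto_rpow_atTop hθ0).eventually_ge_atTop 4,
      (hneg hβ (ρ * (D ^ (2 * σ))⁻¹)).eventually_lt_const (lt_min hκ hδ),
      (hneg (neg_lt_zero.2 hε0) C₁).eventually_lt_const hδ,
      ((tendsto_rpow_atTop hε0).const_mul_atTop hC₂).eventually_gt_atTop δ⁻¹]
      with N h1 h2 h3 h4 h5 using ⟨h1, h2, h3, h4, h5⟩
  obtain ⟨N, hN1, hNθ, hNT, hNδ, hNδ'⟩ := key.exists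
  have hN : 0 < N := by linarith
  have hApow : ∀ a : ℝ, (N ^ (1 - θ)) ^ a = N ^ ((1 - θ) * a) := fun a =>
    (Real.rpow_mul hN.le _ _).symm
  have hRA : N ^ (-s - ε - (1 - θ) * (d * q)) * (N ^ (1 - θ)) ^ d = N ^ α := by
    rw [← Real.rpow_natCast, hApow, ← Real.rpow_add hN, hα]
    congr 1; ring
  have hTN : ρ * (D ^ (2 * σ))⁻¹ * N ^ (-(2 * σ * α)) * N ^ 2 =
      ρ * (D ^ (2 * σ))⁻¹ * N ^ (2 - 2 * σ * α) := by
    rw [mul_assoc, ← Real.rpow_natCast N 2, ← Real.rpow_add hN]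
    congr 2; push_cast; ring
  have hTlt : ρ * (D ^ (2 * σ))⁻¹ * N ^ (-(2 * σ * α)) * N ^ 2 < min κ δ := by rwa [hTN]
  refine ⟨N, N ^ (1 - θ), N ^ (-s - ε - (1 - θ) * (d * q)),
    ρ * (D ^ (2 * σ))⁻¹ * N ^ (-(2 * σ * α)), hN, Real.one_le_rpow hN1 (by linarith),
    by positivity, by positivity, ?_, ?_, ?_, (hTlt.trans_le (min_le_left _ _)).le, ?_, ?_⟩
  · refine lt_of_le_of_lt ?_ (hTlt.trans_le (min_le_right _ _))
    exact le_mul_of_one_le_right (by positivity) (one_le_pow₀ hN1)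
  · calc 4 * N ^ (1 - θ) ≤ N ^ θ * N ^ (1 - θ) := by gcongr
      _ = N := by rw [← Real.rpow_add hN]; simp
  · rw [hRA, mul_pow, ← Real.rpow_natCast (N ^ α), ← Real.rpow_mul hN.le]
    have h1 : N ^ (-(2 * σ * α)) * N ^ (α * ((2 * σ : ℕ) : ℝ)) = 1 := by
      rw [← Real.rpow_add hN]
      push_cast
      rw [show -(2 * (σ : ℝ) * α) + α * (2 * σ) = 0 by ring, Real.rpow_zero]
    calc _ = ρ * ((D ^ (2 * σ))⁻¹ * D ^ (2 * σ)) *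
          (N ^ (-(2 * σ * α)) * N ^ (α * ((2 * σ : ℕ) : ℝ))) := by ring
      _ = ρ := by rw [h1, inv_mul_cancel₀ (by positivity)]; ring
  · rw [hApow, ← Real.rpow_add hN, ← Real.rpow_add hN]
    refine lt_of_eq_of_lt ?_ hNδ
    congr 2; ring
  · rw [hApow, hApow, ← Real.rpow_add hN, ← Real.rpow_add hN]
    refine lt_of_lt_of_eq hNδ' ?_
    congr 2; rw [hε]; ring

end NLS


end

theorem theorem1p1 (d σ : ℕ) (hd : 1 ≤ d) (hσ : 1 ≤ σ) (μ : ℝ) (hμ : μ = 1 ∨ μ = -1)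
    (p : ℝ≥0∞) (hp : 1 ≤ p) (s : ℝ) (hs : s < min 0 (NLS.criticalExponent d σ p))
    (δ : ℝ) (hδ : 0 < δ) :
    ∃ (ψ₀ : NLS.L2 d) (T : ℝ) (ψ : ℝ → NLS.L2 d),
      NLS.flNorm p s (ψ₀ : 𝓢'(NLS.Space d, ℂ)) < ENNReal.ofReal δ ∧
      0 < T ∧ T < δ ∧
      NLS.IsSolution σ μ T ψ₀ ψ ∧
      (∀ ψ' : ℝ → NLS.L2 d, NLS.IsSolution σ μ T ψ₀ ψ' → ∀ t ∈ Set.Icc 0 T, ψ' t = ψ t) ∧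
      (∀ t ∈ Set.Icc 0 T, NLS.MemFL p s (ψ t : 𝓢'(NLS.Space d, ℂ))) ∧
      ENNReal.ofReal δ⁻¹ < NLS.flNorm p s (ψ T : 𝓢'(NLS.Space d, ℂ)) := by
  have hμ1 : |μ| = 1 := by rcases hμ with rfl | rfl <;> simp
  obtain ⟨hs0, hsc⟩ := lt_min_iff.1 hs
  obtain ⟨D, ρ, κ, c, hD, hρ, hκ, hc, hsol⟩ := NLS.exists_solution_with_growth hd hσ
  set ω := volume.real (Metric.ball (0 : NLS.Space d) 1) with hω
  have hω0 : 0 < ω := ENNReal.toReal_pos (Metric.measure_ball_pos _ _ one_pos).ne'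
    measure_ball_lt_top.ne
  obtain ⟨N, A, R, T, hN, hA, hR, hT, hTδ, hAN, hTρ, hTκ, hdata, hgrowth⟩ :=
    NLS.exists_parameters (d := d) (q := (p⁻¹).toReal) hσ ENNReal.toReal_nonneg hs0 hsc hD hρ hκ
      (C₁ := 2 * (2 * ((2 * Real.pi) ^ d * ω)) ^ (p⁻¹).toReal)
      (C₂ := ((2 * Real.pi) ^ d)⁻¹ * 2 ^ s *
        ((2 * Real.pi) ^ d * ω * (1 / 6) ^ d) ^ (p⁻¹).toReal * c) (by positivity) hδ
  have hv : ‖EuclideanSpace.single (⟨0, hd⟩ : Fin d) N‖ = N := by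
    rw [PiLp.norm_single, Real.norm_of_nonneg hN.le]
  set v : NLS.Space d := EuclideanSpace.single (⟨0, hd⟩ : Fin d) N
  have hA0 : 0 < A := by linarith
  obtain ⟨hm₀, u, hm, hψ, hLp, hlow⟩ := hsol μ A R T v hμ1 hA0 hR hT (by rwa [hv]) hTρ
    (by rwa [hv])
  refine ⟨_, T, _, ?_, hT, hTδ, hψ, fun ψ' h' => h'.unique hμ1.le hT.le hψ,
    fun t _ => NLS.memFL_ofFourier hs0.le _ (hLp t p hp), ?_⟩
  · refine (NLS.flNorm_data_le p hs0.le hA0 hR (by rwa [hv]) hm₀).trans_lt ?_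
    rw [hv]
    exact (ENNReal.ofReal_lt_ofReal_iff hδ).2 hdata
  · refine lt_of_lt_of_le ?_
      (NLS.le_flNorm_ofFourier hp hs0.le hA (by positivity) (hm T) hlow)
    refine (ENNReal.ofReal_lt_ofReal_iff (by rw [← hω]; positivity)).2 (hgrowth.trans_eq ?_)
    rw [← hω]
    ring
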